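/- **Setting.** All logarithms are to base 2. A quantum stochastic linear bandit with rewards in $[0,1]$ consists of an action set $A\subseteq\mathbb R^d$ ($d\ge 1$), an unknown $\theta^*\in\mathbb R^d$, with $\|x\|_2\le L$ for $x\in A$ and $\|\theta^*\|_2\le S$ ($L,S>0$), a finite sample space $\Omega$, and for every $x\in A$ a probability measure $P_x$ on $\Omega$ and a reward $y^x:\Omega\to[0,1]$ with mean $x^{\top}\theta^*$, encoded in a unitary $\mathcal O_x:|0\rangle\mapsto\sum_{\omega}\sqrt{P_x(\omega)}\,|\omega\rangle|y^x(\omega)\rangle$. Let $x^*\in A$ maximise $x^{\top}\theta^*$ over $A$. If $x_t$ is the action of round $t$, the regret is $R(T)=\sum_{t=1}^T(x^*-x_t)^{\top}\theta^*$. **Quantum Monte Carlo.** A quantum Monte Carlo method with constant $C_1$ is a family of quantum algorithms $\mathrm{QMC}_1(\cdot,\epsilon,\delta)$ ($\epsilon>0$, $0<\delta\le\frac12$) with oracle access that, for every unitary $\mathcal O$ encoding a probability measure on $\Omega$ and a reward $y\in[0,1]$, uses at most $\frac{C_1}{\epsilon}\log\frac1\delta$ queries to $\mathcal O$ and $\mathcal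 O^\dagger$ and returns $\hat y$ with $\Pr(|\hat y-\mathbb E[y]|\ge\epsilon)\le\delta$; the algorithms do not depend on $\mathcal O$. **Algorithm $\mathrm{QLinUCB}_1(\delta)$.** Fix $\lambda>0$ and a horizon $T$; put $m=d\log\!\left(\frac{L^2T^2}{d\lambda}+1\right)$, $V_0=\lambda I_d$, $\hat\theta_0=0$. In stage $s=1,2,\dots$ let $\mathcal C_{s-1}=\{\theta:\|\theta-\hat\theta_{s-1}\|_{V_{s-1}}\le\lambda^{1/2}S+\sqrt{d(s-1)}\}$, let $(x_s,\tilde\theta_s)$ be any maximiser of $x^{\top}\theta$ over $A\times\mathcal C_{s-1}$ (assumed to exist), and $\epsilon_s=\|x_s\|_{V_{s-1}^{-1}}$. Play $x_s$ for $\frac{C_1}{\epsilon_s}\log\frac m\delta$ rounds (rounded up; all remaining rounds if $\epsilon_s=0$), running $\mathrm{QMC}_1(\mathcal O_{x_s},\epsilon_s,\delta/m)$ to get $y_s$; then set $V_s=V_{s-1}+\epsilon_s^{-2}x_sx_s^{\top}$ and $\hat\theta_s=V_s^{-1}\sum_{k\le s}\epsilon_k^{-2}y_kx_k$. Stop after $T$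 rounds in total (the last stage is cut off if necessary). **Theorem.** 1. There is $C_1>1$ such that for every finite $\Omega$ a quantum Monte Carlo method with constant $C_1$ exists. 2. $\det V_s=2\det V_{s-1}$ for every stage with $x_s\neq0$. For every $C_1>1$ and every quantum Monte Carlo method with constant $C_1$ used in $\mathrm{QLinUCB}_1$: 3. There is a constant $K$ depending only on $C_1,\lambda,S$ such that, whenever $0<\delta<1$, $m\ge1$ and $m\ge2\delta$, with probability at least $1-\delta$ the regret of $\mathrm{QLinUCB}_1(\delta)$ satisfies $$R(T)\le K\,d^2\log^{3/2}\!\left(\tfrac{L^2T^2}{d\lambda}+1\right)\log\tfrac m\delta .$$ 4. There is a constant $K'$ depending only on $C_1,\lambda,S,L$ such that, whenever $T\ge2$ and $L^2T^2\ge d\lambda$, the regret of $\mathrm{QLinUCB}_1(\frac mT)$ satisfies $$\mathbb E[R(T)]\le K'\,d^2\log^{5/2}\!\left(\tfrac{L^2T^2}{d\lambda}+1\right).$$ -/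

import Mathlib

open scoped ENNReal InnerProductSpace Matrix

noncomputable section

namespace QBandit

/-! ### Quantum registers, reward oracles and quantum algorithms with oracle access -/

/-- The query register: the Hilbert space with orthonormal basis `|ω⟩|r⟩`, where `ω` runs over the
finite sample space and `r` over the real numbers. -/
abbrev Reg (Ω : Type) : Type := lp (fun _ : Ω × ℝ => ℂ) 2

/-- The basis state `|ω⟩|r⟩` of the query register. -/
def ket {Ω : Type} (ω : Ω) (r : ℝ) : Reg Ω := by
  classical exact lp.single 2 (ω, r) (1 : ℂ)

/-- The unitary `O` encodes the probability measure `P` and the reward `y`: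
it maps `|0⟩ = |ω₀⟩|0⟩` to `∑ ω, √(P ω) |ω⟩|y ω⟩`. -/
def Encodes {Ω : Type} [Fintype Ω] (ω₀ : Ω) (O : Reg Ω ≃ₗᵢ[ℂ] Reg Ω)
    (P : PMF Ω) (y : Ω → ℝ) : Prop :=
  O (ket ω₀ 0) = ∑ ω, ((Real.sqrt (P ω).toReal : ℝ) : ℂ) • ket ω (y ω)

/-- The expectation of `y` under `P`. -/
def mean {Ω : Type} [Fintype Ω] (P : PMF Ω) (y : Ω → ℝ) : ℝ := ∑ ω, (P ω).toReal * y ω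

/-- The joint space of the query register and a finite-dimensional workspace with basis `W`
(the tensor product of `Reg Ω` with `ℂ^W`; the coordinate `w` is the part of the state that
multiplies `|w⟩`). -/
abbrev Joint (Ω W : Type) [Fintype W] : Type := PiLp 2 (fun _ : W => Reg Ω)

/-- The oracle acting on the query register, and as the identity on the workspace. -/
def liftOracle {Ω W : Type} [Fintype W] (O : Reg Ω ≃ₗᵢ[ℂ] Reg Ω) :
    Joint Ω W ≃ₗᵢ[ℂ] Joint Ω W :=
  LinearIsometryEquiv.piLpCongrRight 2 (fun _ => O)

/-- Oracle programs. A program does not contain the oracle; it can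
halt with a real output, restart from the initial state, apply a fixed unitary,
query the oracle (or, if the flag is `true`, its inverse), or perform a measurement with
finitely many outcomes (measurement operators `M i` with `∑ (M i)† (M i) = 1`) and branch on
the observed outcome. -/
inductive Prog (Ω W : Type) [Fintype W] : Type
  | halt (r : ℝ) : Prog Ω W
  | restart (next : Prog Ω W) : Prog Ω W
  | gate (U : Joint Ω W ≃ₗᵢ[ℂ] Joint Ω W) (next : Prog Ω W) : Prog Ω W
  | query (inverse : Bool) (next : Prog Ω W) : Prog Ω W
  | measure (k : ℕ) (M : Fin k → (Joint Ω W →L[ℂ] Joint Ω W))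
      (complete : ∑ i, (ContinuousLinearMap.adjoint (M i)) ∘L (M i) =
        ContinuousLinearMap.id ℂ (Joint Ω W))
      (next : Fin k → Prog Ω W) : Prog Ω W

/-- The largest number of uses of the oracle or its inverse on any branch. -/
def Prog.queries {Ω W : Type} [Fintype W] : Prog Ω W → ℕ
  | .halt _ => 0
  | .restart next => next.queries
  | .gate _ next => next.queries
  | .query _ next => next.queries + 1
  | .measure _ _ _ next => Finset.univ.sup fun i => (next i).queries

/-- The probability of reaching the current point in the unnormalised state `ψ` (the squared norm
of `ψ`) and then halting with output `r`. The initial state is `init`. -/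
def Prog.weight {Ω W : Type} [Fintype W] (O : Reg Ω ≃ₗᵢ[ℂ] Reg Ω) (init : Joint Ω W) :
    Prog Ω W → Joint Ω W → ℝ → ℝ≥0∞
  | .halt r', ψ, r => by
      classical exact if r = r' then ENNReal.ofReal (‖ψ‖ ^ 2) else 0
  | .restart next, ψ, r => next.weight O init (((‖ψ‖ : ℝ) : ℂ) • init) r
  | .gate U next, ψ, r => next.weight O init (U ψ) r
  | .query inverse next, ψ, r =>
      next.weight O init (if inverse then (liftOracle O).symm ψ else liftOracle O ψ) r
  | .measure _ M _ next, ψ, r => ∑ i, (next i).weight O init (M i ψ) r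

lemma sum_norm_sq {Ω W : Type} [Fintype W] {k : ℕ} (M : Fin k → (Joint Ω W →L[ℂ] Joint Ω W))
    (hM : ∑ i, (ContinuousLinearMap.adjoint (M i)) ∘L (M i) =
        ContinuousLinearMap.id ℂ (Joint Ω W)) (ψ : Joint Ω W) :
    ∑ i, ‖M i ψ‖ ^ 2 = ‖ψ‖ ^ 2 := by
  have h1 : ∀ i, ‖M i ψ‖ ^ 2 =
      RCLike.re (inner ℂ (((ContinuousLinearMap.adjoint (M i)) ∘L (M i)) ψ) ψ) := fun i =>
    ContinuousLinearMap.apply_norm_sq_eq_inner_adjoint_left (M i) ψ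
  simp only [h1]
  rw [← map_sum, ← sum_inner, ← sum_apply, hM,
    ContinuousLinearMap.id_apply]
  exact inner_self_eq_norm_sq ψ

lemma Prog.tsum_weight {Ω W : Type} [Fintype W] (O : Reg Ω ≃ₗᵢ[ℂ] Reg Ω) (init : Joint Ω W)
    (hinit : ‖init‖ = 1) (p : Prog Ω W) (ψ : Joint Ω W) :
    ∑' r, p.weight O init ψ r = ENNReal.ofReal (‖ψ‖ ^ 2) := by
  induction p generalizing ψ with
  | halt r' =>
    simp only [Prog.weight]
    rw [tsum_ite_eq]
  | restart next ih =>
    simp only [Prog.weight]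
    rw [ih, norm_smul, hinit]
    simp
  | gate U next ih =>
    simp only [Prog.weight]
    rw [ih, LinearIsometryEquiv.norm_map]
  | query inverse next ih =>
    simp only [Prog.weight]
    rw [ih]
    cases inverse <;> simp
  | measure k M hM next ih =>
    simp only [Prog.weight]
    rw [Summable.tsum_finsetSum (fun _ _ => ENNReal.summable)]
    simp only [ih]
    rw [← ENNReal.ofReal_sum_of_nonneg (fun _ _ => by positivity), sum_norm_sq M hM]

/-- A quantum algorithm with oracle access and a real output: a workspace, the basis state in
which the workspace starts, and a program. -/
structure QAlg (Ω : Type) where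
  W : Type
  [fin : Fintype W]
  w₀ : W
  prog : Prog Ω W

attribute [instance] QAlg.fin

/-- The initial state `|0⟩|w₀⟩`, where `|0⟩ = |ω₀⟩|0⟩`. -/
def QAlg.init {Ω : Type} (ω₀ : Ω) (q : QAlg Ω) : Joint Ω q.W := by
  classical exact PiLp.single 2 q.w₀ (ket ω₀ 0)

lemma QAlg.norm_init {Ω : Type} (ω₀ : Ω) (q : QAlg Ω) : ‖q.init ω₀‖ = 1 := by
  classical
  have h : ‖ket ω₀ (0 : ℝ)‖ = 1 := by
    unfold ket
    rw [lp.norm_single (by norm_num)]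
    simp
  unfold QAlg.init
  rw [PiLp.norm_single]
  exact h

/-- The law of the output of the quantum algorithm when it is run with the oracle `O`. -/
def QAlg.out {Ω : Type} (ω₀ : Ω) (q : QAlg Ω) (O : Reg Ω ≃ₗᵢ[ℂ] Reg Ω) : PMF ℝ :=
  ⟨q.prog.weight O (q.init ω₀) (q.init ω₀), by
    have h := Prog.tsum_weight O (q.init ω₀) (q.norm_init ω₀) q.prog (q.init ω₀)
    rw [q.norm_init ω₀] at h
    have h1 : ∑' r, q.prog.weight O (q.init ω₀) (q.init ω₀) r = 1 := by simpa using h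
    exact h1 ▸ ENNReal.summable.hasSum⟩

/-- A quantum Monte Carlo method for rewards in `[0,1]` with constant `C₁`: for accuracy `ε` and
failure probability `δ`, the algorithm `Q ε δ` (which knows neither the oracle nor
the distribution) uses at most `(C₁ / ε) log (1 / δ)` queries, and its output is at distance
at least `ε` from the mean reward with probability at most `δ`. -/
structure IsQMC {Ω : Type} [Fintype Ω] (ω₀ : Ω) (C₁ : ℝ) (Q : ℝ → ℝ → QAlg Ω) : Prop where
  queries_le : ∀ ε δ : ℝ, 0 < ε → 0 < δ → δ ≤ 1 / 2 →
    ((Q ε δ).prog.queries : ℝ) ≤ C₁ / ε * Real.logb 2 (1 / δ)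
  accurate : ∀ ε δ : ℝ, 0 < ε → 0 < δ → δ ≤ 1 / 2 →
    ∀ (P : PMF Ω) (y : Ω → ℝ) (O : Reg Ω ≃ₗᵢ[ℂ] Reg Ω),
      (∀ ω, y ω ∈ Set.Icc (0 : ℝ) 1) → Encodes ω₀ O P y →
      ((Q ε δ).out ω₀ O).toOuterMeasure {r | ε ≤ |r - mean P y|} ≤ ENNReal.ofReal δ

/-! ### Quantum stochastic linear bandits -/

/-- Actions and parameters live in Euclidean space. -/
abbrev Vec (d : ℕ) : Type := EuclideanSpace ℝ (Fin d)

/-- A quantum stochastic linear bandit with rewards in `[0,1]`, action norms at most `L` and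
parameter norm at most `S`. (Outside the action set the data are irrelevant.) -/
structure QSLB (d : ℕ) (Ω : Type) [Fintype Ω] (ω₀ : Ω) (L S : ℝ) where
  A : Set (Vec d)
  θ : Vec d
  P : Vec d → PMF Ω
  y : Vec d → Ω → ℝ
  O : Vec d → (Reg Ω ≃ₗᵢ[ℂ] Reg Ω)
  norm_action : ∀ x ∈ A, ‖x‖ ≤ L
  norm_param : ‖θ‖ ≤ S
  reward_mem : ∀ x ∈ A, ∀ ω, y x ω ∈ Set.Icc (0 : ℝ) 1
  mean_reward : ∀ x ∈ A, mean (P x) (y x) = ⟪x, θ⟫_ℝ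
  encodes : ∀ x ∈ A, Encodes ω₀ (O x) (P x) (y x)

/-- The regret of a sequence of played actions, relative to the action `xs`. -/
def regret {d : ℕ} (θ xs : Vec d) (l : List (Vec d)) : ℝ := (l.map fun x => ⟪xs - x, θ⟫_ℝ).sum

/-! ### The algorithm -/

/-- The upper bound `m = d log (L² T² / (d λ) + 1)` on the number of stages. -/
def numStages (d : ℕ) (L lam : ℝ) (T : ℕ) : ℝ :=
  d * Real.logb 2 (L ^ 2 * T ^ 2 / (d * lam) + 1)

/-- The completed stages, latest first: the action of the stage and the estimate obtained. -/
abbrev Hist (d : ℕ) : Type := List (Vec d × ℝ)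

/-- The weighted norm `‖x‖_M = √(xᵀ M x)`. -/
def wnorm {d : ℕ} (M : Matrix (Fin d) (Fin d) ℝ) (x : Vec d) : ℝ :=
  Real.sqrt (x.ofLp ⬝ᵥ (M *ᵥ x.ofLp))

/-- `V_s = λ I + ∑ x_k x_kᵀ / ε_k²`, with `ε_k = ‖x_k‖` in the norm of `V_{k-1}⁻¹`. -/
def V {d : ℕ} (lam : ℝ) : Hist d → Matrix (Fin d) (Fin d) ℝ
  | [] => lam • (1 : Matrix (Fin d) (Fin d) ℝ)
  | (x, _) :: h => V lam h + (1 / wnorm (V lam h)⁻¹ x ^ 2) • Matrix.vecMulVec x.ofLp x.ofLp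

/-- The accuracy `ε_s` of the stage that follows the history `h` and plays `x`. -/
def eps {d : ℕ} (lam : ℝ) (h : Hist d) (x : Vec d) : ℝ := wnorm (V lam h)⁻¹ x

/-- `X_sᵀ W_s Y_s = ∑ (y_k / ε_k²) x_k`. -/
def XWY {d : ℕ} (lam : ℝ) : Hist d → (Fin d → ℝ)
  | [] => 0
  | (x, y) :: h => XWY lam h + (y / eps lam h x ^ 2) • x.ofLp

/-- The weighted regularised least squares estimator `V_s⁻¹ X_sᵀ W_s Y_s`. -/
def thetaHat {d : ℕ} (lam : ℝ) (h : Hist d) : Vec d :=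
  WithLp.toLp 2 ((V lam h)⁻¹ *ᵥ XWY lam h)

/-- The confidence region. -/
def conf {d : ℕ} (lam S : ℝ) (h : Hist d) : Set (Vec d) :=
  {θ | wnorm (V lam h) (θ - thetaHat lam h) ≤ Real.sqrt lam * S + Real.sqrt (d * h.length)}

/-- The histories that can arise when actions are selected by `sel`. -/
inductive IsHist {d : ℕ} (sel : Hist d → Vec d × Vec d) : Hist d → Prop
  | nil : IsHist sel []
  | cons (h : Hist d) (y : ℝ) : IsHist sel h → IsHist sel (((sel h).1, y) :: h)

/-- `sel` is an optimistic selection rule (with arbitrary choice among several maximisers): after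
every history that can arise, it returns a maximiser `(x, θ)` of `xᵀ θ` over the product of the
action set and the current confidence region. -/
def IsArgmaxRule {d : ℕ} (lam S : ℝ) (A : Set (Vec d)) (sel : Hist d → Vec d × Vec d) : Prop :=
  ∀ h, IsHist sel h → (sel h).1 ∈ A ∧ (sel h).2 ∈ conf lam S h ∧
    ∀ x ∈ A, ∀ θ ∈ conf lam S h, ⟪x, θ⟫_ℝ ≤ ⟪(sel h).1, (sel h).2⟫_ℝ

/-- The number `(C₁ / ε) log (m / δ)` of rounds of a stage, rounded up, and at least one. -/
def stageLen (C₁ m δ ε : ℝ) : ℕ := max 1 ⌈C₁ / ε * Real.logb 2 (m / δ)⌉₊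

/-- The law of the actions in the last `n` rounds, given the history `h` of completed stages.
A stage plays its action for `stageLen` rounds and then observes the output of the quantum Monte
Carlo method with accuracy `ε` and failure probability `δ / m`. If no more than that many rounds
are left, or if `ε = 0` (when the stage has infinite length), the stage is the last one and
its action is played in all rounds that are left. -/
def play {d : ℕ} {Ω : Type} (ω₀ : Ω) (O : Vec d → (Reg Ω ≃ₗᵢ[ℂ] Reg Ω))
    (Q : ℝ → ℝ → QAlg Ω) (sel : Hist d → Vec d × Vec d) (C₁ lam m δ : ℝ)
    (n : ℕ) (h : Hist d) : PMF (List (Vec d)) := by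
  classical exact
    let x := (sel h).1
    let ε := eps lam h x
    let N := stageLen C₁ m δ ε
    if n ≤ N ∨ ε = 0 then PMF.pure (List.replicate n x)
    else ((Q ε (δ / m)).out ω₀ (O x)).bind fun y =>
      (play ω₀ O Q sel C₁ lam m δ (n - N) ((x, y) :: h)).map fun l => List.replicate N x ++ l
termination_by n
decreasing_by
  rename_i hn
  have : 1 ≤ stageLen C₁ m δ (eps lam h (sel h).1) := le_max_left _ _
  push Not at hn
  omega

/-- `QLinUCB₁(δ)` with horizon `T`: the law of the sequence of actions played. -/
def QLinUCB₁ {d : ℕ} {Ω : Type} [Fintype Ω] {ω₀ : Ω} {L S : ℝ} (B : QSLB d Ω ω₀ L S)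
    (Q : ℝ → ℝ → QAlg Ω) (sel : Hist d → Vec d × Vec d) (C₁ lam : ℝ) (T : ℕ) (δ : ℝ) :
    PMF (List (Vec d)) :=
  play ω₀ B.O Q sel C₁ lam (numStages d L lam T) δ T []

/-- The expectation of (the positive part of) `f`. -/
def expectation {α : Type*} (p : PMF α) (f : α → ℝ) : ℝ≥0∞ := ∑' a, p a * ENNReal.ofReal (f a)

end QBandit

end

/-! Quantum Monte Carlo. Put the reward register next to a qubit and let `S` be the reflection whose
qubit block is `[[a, b], [b, -a]]`, with `a = y - c` and `b = √(1 - a²)`. In the prepared state `ψ =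
O|0⟩` its expectation is `E[y] - c = sin t`. Alternating `S` with the reflection in the line of `ψ`
stays in the plane of `ψ` and `S ψ`, and after `2 j` steps the expectation of `S` is `sin ((4 j + 1)
t)` (`walkState_signal`). Measuring `S` therefore compares the mean with `c`, and `4 j + 1 ≈ 1 / w`
queries amplify a gap of order `w` to a constant bias (`sin_walkHalfLen`). A search uses majority
votes of this test: if the mean is known up to `w`, a vote discards an outer third of the interval,
and in the middle third either verdict is right. With `i` rounds still to come after the current one
it takes a number of votes proportional to `ℓ + i + 1`. The failure probabilities then form a
geometric series with sum at most `δ`, and since the expensive late rounds get the fewest votes, the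
cost stays of order `(1 / ε) log (1 / δ)` without a further logarithm (`mass_searchProg_le`,
`queries_searchProg`).

Regret. By the matrix determinant lemma the weight `1 / ε²` makes each stage double `det V`
(`det_V_cons`). A completed stage lasts at least `1 / ε` rounds, so `∑ 1 / ε ≤ T`, which bounds the
trace of `V`; the inequality between the arithmetic and the geometric mean of the eigenvalues then
allows at most `m` completed stages (`Accurate.length_le`). As long as all estimates are accurate,
Cauchy–Schwarz keeps the true parameter in the confidence region (`Accurate.mem_conf`). By optimism
the gap of a stage is then at most `ε` times twice the radius; multiplied by a length of order `(1 /
ε) log (m / δ)` the accuracy cancels, so every stage costs about the same (`mul_gap_le_stageBound`).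
A union bound over the stages, carried out along the recursion of `play`, gives the tail bound
`play_regret_tail`. For the expectation, `δ = m / T` makes the failure event contribute at most `δ T
= m`; the remaining factor `log T` is absorbed if `d² ≤ T`, and otherwise the trivial bound `T < d²`
suffices. -/

noncomputable section

namespace QBandit

/-! ### Reflections and multiplication operators -/

/-- A symmetric involution of an inner product space is a linear isometry equivalence. -/
def symmInvolution {H : Type*} [NormedAddCommGroup H] [InnerProductSpace ℂ H] (f : H →ₗ[ℂ] H)
    (hi : Function.Involutive f) (hs : f.IsSymmetric) : H ≃ₗᵢ[ℂ] H where
  toLinearEquiv := LinearEquiv.ofInvolutive f hi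
  norm_map' v := by
    change ‖f v‖ = ‖v‖
    have h : inner ℂ (f v) (f v) = inner ℂ v v := by rw [hs, hi]
    rw [inner_self_eq_norm_sq_to_K, inner_self_eq_norm_sq_to_K] at h
    have h2 : ‖f v‖ ^ 2 = ‖v‖ ^ 2 := by exact_mod_cast h
    exact (sq_eq_sq₀ (norm_nonneg _) (norm_nonneg _)).mp h2

/-- Multiplication by a real function bounded by one on `ℓ²`. -/
def mulOp {ι : Type} (a : ι → ℝ) (ha : ∀ i, |a i| ≤ 1) :
    lp (fun _ : ι => ℂ) 2 →ₗ[ℂ] lp (fun _ : ι => ℂ) 2 where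
  toFun f := ⟨fun i => (a i : ℂ) * f i, (lp.memℓp f).norm.mono (fun i => by
    rw [norm_mul, Complex.norm_real, Real.norm_eq_abs]
    exact mul_le_of_le_one_left (norm_nonneg _) (ha i))⟩
  map_add' f g := by
    ext i
    change (a i : ℂ) * (f i + g i) = a i * f i + a i * g i
    ring
  map_smul' c f := by
    ext i
    change (a i : ℂ) * (c * f i) = c * (a i * f i)
    ring

@[simp] lemma mulOp_apply {ι : Type} (a : ι → ℝ) (ha : ∀ i, |a i| ≤ 1)
    (f : lp (fun _ : ι => ℂ) 2) (i : ι) : mulOp a ha f i = a i * f i := rfl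

lemma mulOp_symm {ι : Type} (a : ι → ℝ) (ha : ∀ i, |a i| ≤ 1) (f g : lp (fun _ : ι => ℂ) 2) :
    inner ℂ (mulOp a ha f) g = inner ℂ f (mulOp a ha g) := by
  rw [lp.inner_eq_tsum, lp.inner_eq_tsum]
  congr 1
  ext i
  simp only [mulOp_apply, RCLike.inner_apply, map_mul, Complex.conj_ofReal]
  ring

lemma mulOp_single {ι : Type} [DecidableEq ι] (a : ι → ℝ) (ha : ∀ i, |a i| ≤ 1) (i : ι) :
    mulOp a ha (lp.single 2 i (1 : ℂ)) = (a i : ℂ) • lp.single 2 i (1 : ℂ) := by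
  ext j
  rw [mulOp_apply, lp.coeFn_smul, Pi.smul_apply, smul_eq_mul]
  by_cases h : j = i
  · subst h; rfl
  · rw [lp.single_apply_ne _ _ _ h]; simp

/-- The reward relative to the level `c`, truncated to `[-1,1]`. -/
def offset {Ω : Type} (c : ℝ) (z : Ω × ℝ) : ℝ := max (-1) (min 1 (z.2 - c))

/-- The complementary amplitude `√(1 - offset²)`. -/
def coOffset {Ω : Type} (c : ℝ) (z : Ω × ℝ) : ℝ := Real.sqrt (1 - offset c z ^ 2)

lemma abs_offset_le {Ω : Type} (c : ℝ) (z : Ω × ℝ) : |offset c z| ≤ 1 := by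
  rw [abs_le]
  exact ⟨le_max_left _ _, max_le (by norm_num) (min_le_left _ _)⟩

lemma abs_coOffset_le {Ω : Type} (c : ℝ) (z : Ω × ℝ) : |coOffset c z| ≤ 1 := by
  rw [coOffset, abs_of_nonneg (Real.sqrt_nonneg _)]
  exact Real.sqrt_le_one.mpr (by nlinarith [sq_nonneg (offset c z)])

lemma offset_sq_add_coOffset_sq {Ω : Type} (c : ℝ) (z : Ω × ℝ) :
    offset c z ^ 2 + coOffset c z ^ 2 = 1 := by
  have h := abs_offset_le c z
  have h2 : offset c z ^ 2 ≤ 1 := (sq_le_one_iff_abs_le_one _).mpr h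
  rw [coOffset, Real.sq_sqrt (by linarith)]
  ring

/-- The reflection of the workspace qubit that depends on the reward in the register. -/
def rewardReflLin (Ω : Type) (c : ℝ) : Joint Ω (Fin 2) →ₗ[ℂ] Joint Ω (Fin 2) where
  toFun f := WithLp.toLp 2 ![
    mulOp (offset c) (abs_offset_le c) (f 0) + mulOp (coOffset c) (abs_coOffset_le c) (f 1),
    mulOp (coOffset c) (abs_coOffset_le c) (f 0) - mulOp (offset c) (abs_offset_le c) (f 1)]
  map_add' f g := by
    ext i : 1
    fin_cases i <;> simp <;> abel
  map_smul' a f := by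
    ext i : 1
    fin_cases i <;> simp [smul_add, smul_sub]

lemma rewardReflLin_zero {Ω : Type} (c : ℝ) (f : Joint Ω (Fin 2)) :
    rewardReflLin Ω c f 0 = mulOp (offset c) (abs_offset_le c) (f 0) +
      mulOp (coOffset c) (abs_coOffset_le c) (f 1) := rfl

lemma rewardReflLin_one {Ω : Type} (c : ℝ) (f : Joint Ω (Fin 2)) :
    rewardReflLin Ω c f 1 = mulOp (coOffset c) (abs_coOffset_le c) (f 0) -
      mulOp (offset c) (abs_offset_le c) (f 1) := rfl

/-- At each basis point the operator is the real matrix `[[a, b], [b, -a]]` with `a² + b² = 1`,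
whose square is the identity. -/
lemma rewardReflLin_involutive (Ω : Type) (c : ℝ) :
    Function.Involutive (rewardReflLin Ω c) := by
  intro f
  have key : ∀ z : Ω × ℝ, (offset c z : ℂ) ^ 2 + (coOffset c z : ℂ) ^ 2 = 1 := fun z => by
    exact_mod_cast offset_sq_add_coOffset_sq c z
  ext i z
  fin_cases i
  · change (offset c z : ℂ) * (offset c z * f 0 z + coOffset c z * f 1 z) +
      coOffset c z * (coOffset c z * f 0 z - offset c z * f 1 z) = f 0 z
    linear_combination (f 0 z) * key z
  · change (coOffset c z : ℂ) * (offset c z * f 0 z + coOffset c z * f 1 z) -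
      offset c z * (coOffset c z * f 0 z - offset c z * f 1 z) = f 1 z
    linear_combination (f 1 z) * key z

lemma rewardReflLin_isSymmetric (Ω : Type) (c : ℝ) : (rewardReflLin Ω c).IsSymmetric := by
  intro f g
  rw [PiLp.inner_apply, PiLp.inner_apply, Fin.sum_univ_two, Fin.sum_univ_two]
  simp only [rewardReflLin_zero, rewardReflLin_one, inner_add_left, inner_add_right,
    inner_sub_left, inner_sub_right, mulOp_symm]
  ring

/-- `rewardReflLin` as a unitary. -/
def rewardRefl (Ω : Type) (c : ℝ) : Joint Ω (Fin 2) ≃ₗᵢ[ℂ] Joint Ω (Fin 2) :=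
  symmInvolution _ (rewardReflLin_involutive Ω c) (rewardReflLin_isSymmetric Ω c)

lemma rewardRefl_rewardRefl {Ω : Type} (c : ℝ) (v : Joint Ω (Fin 2)) :
    rewardRefl Ω c (rewardRefl Ω c v) = v := rewardReflLin_involutive Ω c v

lemma rewardRefl_symm {Ω : Type} (c : ℝ) (v w : Joint Ω (Fin 2)) :
    inner ℂ (rewardRefl Ω c v) w = inner ℂ v (rewardRefl Ω c w) :=
  rewardReflLin_isSymmetric Ω c v w

/-- The measurement of the reward reflection. -/
def reflMeas (Ω : Type) (c : ℝ) (i : Fin 2) : Joint Ω (Fin 2) →L[ℂ] Joint Ω (Fin 2) :=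
  (1 / 2 : ℂ) • (ContinuousLinearMap.id ℂ _ +
    (if i = 0 then (1 : ℂ) else -1) • (rewardRefl Ω c).toContinuousLinearEquiv.toContinuousLinearMap)

lemma reflMeas_apply {Ω : Type} (c : ℝ) (i : Fin 2) (v : Joint Ω (Fin 2)) :
    reflMeas Ω c i v = (1 / 2 : ℂ) • (v + (if i = 0 then (1 : ℂ) else -1) • rewardRefl Ω c v) := rfl

lemma inner_reflMeas {Ω : Type} (c : ℝ) (i : Fin 2) (v w : Joint Ω (Fin 2)) :
    inner ℂ (reflMeas Ω c i v) w = inner ℂ v (reflMeas Ω c i w) := by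
  simp only [reflMeas_apply, inner_smul_left, inner_smul_right, inner_add_left, inner_add_right,
    rewardRefl_symm]
  split_ifs <;> simp [map_ofNat]

lemma reflMeas_complete (Ω : Type) (c : ℝ) :
    ∑ i, (ContinuousLinearMap.adjoint (reflMeas Ω c i)) ∘L (reflMeas Ω c i) =
      ContinuousLinearMap.id ℂ (Joint Ω (Fin 2)) := by
  have hadj : ∀ i, ContinuousLinearMap.adjoint (reflMeas Ω c i) = reflMeas Ω c i := fun i => by
    symm
    rw [ContinuousLinearMap.eq_adjoint_iff]
    exact inner_reflMeas c i
  ext1 v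
  simp only [hadj, Fin.sum_univ_two, add_apply, ContinuousLinearMap.comp_apply,
    ContinuousLinearMap.id_apply, reflMeas_apply, map_smul, map_add, rewardRefl_rewardRefl]
  simp only [if_true, one_ne_zero, if_false]
  module

/-- The measurement operators are the spectral projections `(1 ± S) / 2`, so the outcome
probabilities encode the expectation of the reflection. -/
lemma norm_reflMeas_sq {Ω : Type} (c : ℝ) (i : Fin 2) (v : Joint Ω (Fin 2)) :
    ‖reflMeas Ω c i v‖ ^ 2 = (‖v‖ ^ 2 + (if i = 0 then (1 : ℝ) else -1) *
      RCLike.re (inner ℂ v (rewardRefl Ω c v))) / 2 := by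
  rw [reflMeas_apply, norm_smul, mul_pow, norm_add_sq (𝕜 := ℂ), norm_smul,
    LinearIsometryEquiv.norm_map]
  split_ifs <;> simp [inner_neg_right] <;> ring

/-- Reflection in the direction of a unit vector. -/
lemma reflection_unit {H : Type*} [NormedAddCommGroup H] [InnerProductSpace ℂ H] (ψ : H)
    (hψ : ‖ψ‖ = 1) (v : H) :
    (ℂ ∙ ψ).reflection v = (2 * inner ℂ ψ v) • ψ - v := by
  rw [Submodule.reflection_singleton_apply, hψ]
  simp [two_mul, add_smul, two_smul]

/-! ### Amplitude amplification -/

/-- The coefficients of the iterated walk: `(U_k(x), U_{k-1}(x))`. -/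
def walkCoeff (x : ℝ) : ℕ → ℝ × ℝ
  | 0 => (1, 0)
  | k + 1 => (2 * x * (walkCoeff x k).1 - (walkCoeff x k).2, (walkCoeff x k).1)

/-- The recurrence is that of the Chebyshev polynomials of the second kind. Multiplied by `sin φ`,
it is the addition theorem for `sin ((k + 1) φ ± φ)`. -/
lemma walkCoeff_cos (φ : ℝ) (k : ℕ) :
    Real.sin φ * (walkCoeff (Real.cos φ) k).1 = Real.sin ((k + 1) * φ) ∧
      Real.sin φ * (walkCoeff (Real.cos φ) k).2 = Real.sin (k * φ) := by
  induction k with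
  | zero => simp [walkCoeff]
  | succ k ih =>
    refine ⟨?_, by simpa [walkCoeff] using ih.1⟩
    have h1 : Real.sin (((k + 1 : ℕ) + 1 : ℝ) * φ) =
        Real.sin ((k + 1) * φ) * Real.cos φ + Real.cos ((k + 1) * φ) * Real.sin φ := by
      rw [← Real.sin_add]; congr 1; push_cast; ring
    have h2 : Real.sin (k * φ) =
        Real.sin ((k + 1) * φ) * Real.cos φ - Real.cos ((k + 1) * φ) * Real.sin φ := by
      rw [← Real.sin_sub]; congr 1; ring
    rw [h1]
    simp only [walkCoeff]
    linear_combination 2 * Real.cos φ * ih.1 - ih.2 - h2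

/-- The left side is the expectation of `S` in the state `a ψ - b S ψ` when `⟨ψ, S ψ⟩ = cos φ`. The
closed forms of `a` and `b` carry a denominator `sin φ`, so the identity is proved after
multiplication by `sin² φ`. -/
lemma walkCoeff_signal {φ : ℝ} (hφ : Real.sin φ ≠ 0) (k : ℕ) :
    ((walkCoeff (Real.cos φ) k).1 ^ 2 + (walkCoeff (Real.cos φ) k).2 ^ 2) * Real.cos φ -
      2 * (walkCoeff (Real.cos φ) k).1 * (walkCoeff (Real.cos φ) k).2 =
      Real.cos ((2 * k + 1) * φ) := by
  obtain ⟨ha, hb⟩ := walkCoeff_cos φ k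
  set a := (walkCoeff (Real.cos φ) k).1
  set b := (walkCoeff (Real.cos φ) k).2
  have h1 : Real.sin ((k + 1) * φ) =
      Real.sin (k * φ) * Real.cos φ + Real.cos (k * φ) * Real.sin φ := by
    rw [← Real.sin_add]; congr 1; ring
  have h2 : Real.cos ((2 * k + 1) * φ) =
      (2 * Real.cos (k * φ) ^ 2 - 1) * Real.cos φ -
        2 * Real.sin (k * φ) * Real.cos (k * φ) * Real.sin φ := by
    rw [← Real.cos_two_mul, ← Real.sin_two_mul, ← Real.cos_add]; congr 1; ring
  rw [h2]
  have h3 := Real.sin_sq_add_cos_sq φ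
  have h4 := Real.sin_sq_add_cos_sq (k * φ)
  rw [h1] at ha
  set s := Real.sin φ
  set c := Real.cos φ
  set A := Real.sin (k * φ)
  set B := Real.cos (k * φ)
  have hs : s ^ 2 ≠ 0 := pow_ne_zero 2 hφ
  apply mul_left_cancel₀ hs
  have : s ^ 2 * ((a ^ 2 + b ^ 2) * c - 2 * a * b) =
      ((s * a) ^ 2 + (s * b) ^ 2) * c - 2 * (s * a) * (s * b) := by ring
  rw [this, ha, hb]
  have hc2 : c ^ 2 = 1 - s ^ 2 := by linarith
  have hA2 : A ^ 2 = 1 - B ^ 2 := by linarith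
  have : ((A * c + B * s) ^ 2 + A ^ 2) * c - 2 * (A * c + B * s) * A
      = A ^ 2 * c * (c ^ 2) + 2 * A * B * s * c ^ 2 + B ^ 2 * s ^ 2 * c + A ^ 2 * c
        - 2 * A ^ 2 * c - 2 * A * B * s := by ring
  rw [this, hc2, hA2]
  ring

/-- The signal of an even number of walk steps. -/
lemma walkCoeff_sin {t : ℝ} (ht : Real.cos t ≠ 0) (j : ℕ) :
    ((walkCoeff (Real.sin t) (2 * j)).1 ^ 2 + (walkCoeff (Real.sin t) (2 * j)).2 ^ 2) * Real.sin t -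
      2 * (walkCoeff (Real.sin t) (2 * j)).1 * (walkCoeff (Real.sin t) (2 * j)).2 =
      Real.sin ((4 * j + 1) * t) := by
  rw [← Real.cos_pi_div_two_sub t, walkCoeff_signal (by rwa [Real.sin_pi_div_two_sub]),
    ← Real.cos_pi_div_two_sub]
  -- Only an even number of steps gives `+sin`: after an odd number the shift is by `3π / 2` and the
  -- sign is reversed.
  have : (2 * ((2 * j : ℕ) : ℝ) + 1) * (Real.pi / 2 - t) =
      Real.pi / 2 - (4 * j + 1) * t + j * (2 * Real.pi) := by push_cast; ring
  rw [this, Real.cos_add_nat_mul_two_pi]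

section Walk
variable {H : Type*} [NormedAddCommGroup H] [InnerProductSpace ℂ H]

/-- The state after `k` steps of the walk, where a step is the reflection `S` followed by the
reflection in the direction of `ψ`. -/
def walkState (S : H ≃ₗᵢ[ℂ] H) (ψ : H) : ℕ → H
  | 0 => ψ
  | k + 1 => (ℂ ∙ ψ).reflection (S (walkState S ψ k))

lemma norm_walkState (S : H ≃ₗᵢ[ℂ] H) (ψ : H) (k : ℕ) : ‖walkState S ψ k‖ = ‖ψ‖ := by
  induction k with
  | zero => rfl
  | succ k ih => rw [walkState, LinearIsometryEquiv.norm_map, LinearIsometryEquiv.norm_map, ih]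

/-- The plane spanned by `ψ` and `S ψ` is invariant under both reflections, and a step acts on the
coordinates there by the recurrence of `walkCoeff`. -/
lemma walkState_eq {S : H ≃ₗᵢ[ℂ] H} (hS : ∀ v, S (S v) = v) {ψ : H} (hψ : ‖ψ‖ = 1) {x : ℝ}
    (hx : inner ℂ ψ (S ψ) = (x : ℂ)) (k : ℕ) :
    walkState S ψ k = ((walkCoeff x k).1 : ℂ) • ψ - ((walkCoeff x k).2 : ℂ) • S ψ := by
  induction k with
  | zero => simp [walkState, walkCoeff]
  | succ k ih =>
    rw [walkState, reflection_unit ψ hψ, ih, map_sub, map_smul, map_smul, hS, inner_sub_right,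
      inner_smul_right, inner_smul_right, hx, inner_self_eq_norm_sq_to_K, hψ]
    simp only [walkCoeff]
    push_cast
    module

lemma walkState_signal {S : H ≃ₗᵢ[ℂ] H} (hS : ∀ v, S (S v) = v)
    (hSs : ∀ v w, inner ℂ (S v) w = inner ℂ v (S w)) {ψ : H} (hψ : ‖ψ‖ = 1) {t : ℝ}
    (ht : Real.cos t ≠ 0) (hx : inner ℂ ψ (S ψ) = (Real.sin t : ℂ)) (j : ℕ) :
    RCLike.re (inner ℂ (walkState S ψ (2 * j)) (S (walkState S ψ (2 * j)))) =
      Real.sin ((4 * j + 1) * t) := by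
  rw [walkState_eq hS hψ hx, ← walkCoeff_sin ht]
  set a := (walkCoeff (Real.sin t) (2 * j)).1
  set b := (walkCoeff (Real.sin t) (2 * j)).2
  have h1 : inner ℂ (S ψ) ψ = ((Real.sin t : ℝ) : ℂ) := by rw [hSs, hx]
  have h2 : inner ℂ ψ ψ = (1 : ℂ) := by rw [inner_self_eq_norm_sq_to_K, hψ]; simp
  have h3 : inner ℂ (S ψ) (S ψ) = (1 : ℂ) := by
    rw [inner_self_eq_norm_sq_to_K, LinearIsometryEquiv.norm_map, hψ]; simp
  have : inner ℂ ((a : ℂ) • ψ - (b : ℂ) • S ψ) (S ((a : ℂ) • ψ - (b : ℂ) • S ψ)) =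
      (((a ^ 2 + b ^ 2) * Real.sin t - 2 * a * b : ℝ) : ℂ) := by
    rw [map_sub, map_smul, map_smul, hS]
    simp only [inner_sub_left, inner_sub_right, inner_smul_left, inner_smul_right, h1, h2, h3, hx,
      Complex.conj_ofReal]
    push_cast
    ring
  rw [this]
  exact Complex.ofReal_re _

end Walk

/-! ### The probability that a program halts with an output in a given set -/

section Mass
variable {Ω W : Type} [Fintype W] (O : Reg Ω ≃ₗᵢ[ℂ] Reg Ω) (init : Joint Ω W)

/-- The probability of reaching the current point in the state `ψ` and then halting with an output
in `s`. -/
def Prog.mass (p : Prog Ω W) (ψ : Joint Ω W) (s : Set ℝ) : ℝ≥0∞ :=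
  ∑' r, s.indicator (p.weight O init ψ) r

/-- Gates, queries and measurement operators are linear, and a restart keeps only the norm. Hence a
restart splits off the probability `‖ψ‖²` of reaching it as a factor. -/
lemma Prog.weight_smul (p : Prog Ω W) (a : ℂ) (ψ : Joint Ω W) (r : ℝ) :
    p.weight O init (a • ψ) r = ENNReal.ofReal (‖a‖ ^ 2) * p.weight O init ψ r := by
  induction p generalizing a ψ with
  | halt r' =>
    simp only [Prog.weight, norm_smul, mul_pow]
    split_ifs
    · rw [ENNReal.ofReal_mul (by positivity)]
    · simp
  | restart next ih =>
    simp only [Prog.weight]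
    rw [norm_smul, Complex.ofReal_mul, mul_smul, ih]
    simp
  | gate U next ih =>
    simp only [Prog.weight]
    rw [map_smul, ih]
  | query inverse next ih =>
    simp only [Prog.weight]
    cases inverse <;> simp [map_smul, ih]
  | measure k M hM next ih =>
    simp only [Prog.weight, map_smul, ih]
    rw [Finset.mul_sum]

lemma Prog.mass_smul (p : Prog Ω W) (a : ℂ) (ψ : Joint Ω W) (s : Set ℝ) :
    p.mass O init (a • ψ) s = ENNReal.ofReal (‖a‖ ^ 2) * p.mass O init ψ s := by
  rw [Prog.mass, Prog.mass, ← ENNReal.tsum_mul_left]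
  refine tsum_congr fun r => ?_
  by_cases hr : r ∈ s
  · simp [hr, Prog.weight_smul]
  · simp [hr]

lemma Prog.mass_halt (r : ℝ) (ψ : Joint Ω W) (s : Set ℝ) [Decidable (r ∈ s)] :
    (Prog.halt r).mass O init ψ s = if r ∈ s then ENNReal.ofReal (‖ψ‖ ^ 2) else 0 := by
  rw [Prog.mass, tsum_eq_single r]
  · simp [Set.indicator_apply, Prog.weight]
  · intro r' hr
    simp [Prog.weight, hr]

lemma Prog.mass_restart (p : Prog Ω W) (ψ : Joint Ω W) (s : Set ℝ) :
    (Prog.restart p).mass O init ψ s = ENNReal.ofReal (‖ψ‖ ^ 2) * p.mass O init init s := by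
  have h : (Prog.restart p).mass O init ψ s = p.mass O init (((‖ψ‖ : ℝ) : ℂ) • init) s := rfl
  rw [h, Prog.mass_smul]
  simp

lemma Prog.mass_measure {k : ℕ} (M : Fin k → (Joint Ω W →L[ℂ] Joint Ω W))
    (hM : ∑ i, (ContinuousLinearMap.adjoint (M i)) ∘L (M i) =
        ContinuousLinearMap.id ℂ (Joint Ω W)) (next : Fin k → Prog Ω W) (ψ : Joint Ω W)
    (s : Set ℝ) :
    (Prog.measure k M hM next).mass O init ψ s = ∑ i, (next i).mass O init (M i ψ) s := by
  simp only [Prog.mass]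
  rw [← Summable.tsum_finsetSum (fun _ _ => ENNReal.summable)]
  refine tsum_congr fun r => ?_
  by_cases hr : r ∈ s
  · simp [hr, Prog.weight]
  · simp [hr]

lemma Prog.mass_le (hinit : ‖init‖ = 1) (p : Prog Ω W) (ψ : Joint Ω W) (s : Set ℝ) :
    p.mass O init ψ s ≤ ENNReal.ofReal (‖ψ‖ ^ 2) := by
  rw [← Prog.tsum_weight O init hinit p ψ]
  exact ENNReal.tsum_le_tsum fun r => Set.indicator_le_self' (fun _ _ => zero_le) r

/-- A program is fresh if its law does not depend on the state in which it is entered. -/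
def Prog.Fresh (p : Prog Ω W) : Prop :=
  ∀ ψ s, p.mass O init ψ s = ENNReal.ofReal (‖ψ‖ ^ 2) * p.mass O init init s

lemma Prog.fresh_restart (hinit : ‖init‖ = 1) (p : Prog Ω W) : (Prog.restart p).Fresh O init := by
  intro ψ s
  rw [Prog.mass_restart, Prog.mass_restart, hinit]
  simp

lemma Prog.fresh_halt (hinit : ‖init‖ = 1) (r : ℝ) :
    (Prog.halt r : Prog Ω W).Fresh O init := by
  classical
  intro ψ s
  rw [Prog.mass_halt, Prog.mass_halt, hinit]
  split_ifs <;> simp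

end Mass

/-! ### The comparison test -/

/-- The initial state of an algorithm with a single workspace qubit. -/
def startState {Ω : Type} (ω₀ : Ω) : Joint Ω (Fin 2) := by
  classical exact PiLp.single 2 0 (ket ω₀ 0)

lemma norm_startState {Ω : Type} (ω₀ : Ω) : ‖startState ω₀‖ = 1 := by
  classical
  unfold startState
  rw [PiLp.norm_single]
  unfold ket
  rw [lp.norm_single (by norm_num)]
  simp

open Classical in
lemma inner_ket {Ω : Type} (y : Ω → ℝ) (ω ω' : Ω) :
    inner ℂ (ket ω (y ω)) (ket ω' (y ω')) = if ω = ω' then (1 : ℂ) else 0 := by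
  unfold ket
  rw [lp.inner_single_left]
  split_ifs with h
  · subst h; rw [lp.single_apply_self]; simp
  · rw [lp.single_apply_ne]
    · simp
    · intro hh; exact h (Prod.ext_iff.mp hh).1

lemma mulOp_ket {Ω : Type} (a : Ω × ℝ → ℝ) (ha : ∀ i, |a i| ≤ 1) (ω : Ω) (r : ℝ) :
    mulOp a ha (ket ω r) = (a (ω, r) : ℂ) • ket ω r := by
  classical
  unfold ket
  exact mulOp_single a ha _

lemma sum_pmf_toReal {Ω : Type} [Fintype Ω] (P : PMF Ω) : ∑ ω, (P ω).toReal = 1 := by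
  rw [← ENNReal.toReal_sum (fun ω _ => P.apply_ne_top ω),
    ← tsum_fintype (L := .unconditional _), P.tsum_coe]
  rfl

lemma mean_mem_Icc {Ω : Type} [Fintype Ω] (P : PMF Ω) {y : Ω → ℝ}
    (hy : ∀ ω, y ω ∈ Set.Icc (0 : ℝ) 1) : mean P y ∈ Set.Icc (0 : ℝ) 1 := by
  refine ⟨Finset.sum_nonneg fun ω _ => mul_nonneg ENNReal.toReal_nonneg (hy ω).1, ?_⟩
  rw [← sum_pmf_toReal P]
  exact Finset.sum_le_sum fun ω _ => mul_le_of_le_one_right ENNReal.toReal_nonneg (hy ω).2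

/-- The qubit of the prepared state is `|0⟩`, so only the diagonal amplitude `y - c` contributes.
The basis states for different `ω` are orthogonal even when the rewards agree. -/
lemma inner_rewardRefl {Ω : Type} [Fintype Ω] {ω₀ : Ω} {O : Reg Ω ≃ₗᵢ[ℂ] Reg Ω} {P : PMF Ω}
    {y : Ω → ℝ} (hy : ∀ ω, y ω ∈ Set.Icc (0 : ℝ) 1) (hO : Encodes ω₀ O P y) {c : ℝ}
    (hc : c ∈ Set.Icc (0 : ℝ) 1) :
    inner ℂ (liftOracle O (startState ω₀)) (rewardRefl Ω c (liftOracle O (startState ω₀))) =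
      ((mean P y - c : ℝ) : ℂ) := by
  classical
  set ψ := liftOracle O (startState ω₀) with hψ
  have h0 : ψ 0 = ∑ ω, ((Real.sqrt (P ω).toReal : ℝ) : ℂ) • ket ω (y ω) := by
    rw [← hO]
    change O (startState ω₀ 0) = _
    simp [startState]
  have h1 : ψ 1 = 0 := by
    change O (startState ω₀ 1) = _
    simp [startState]
  -- Rewards and level lie in `[0,1]`, so the truncation is inactive.
  have hoff : ∀ ω, offset c (ω, y ω) = y ω - c := fun ω => by
    have := hy ω
    simp only [Set.mem_Icc] at this hc
    rw [offset, min_eq_right (by linarith), max_eq_right (by linarith)]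
  rw [PiLp.inner_apply, Fin.sum_univ_two, h1, inner_zero_left, add_zero]
  change inner ℂ (ψ 0) (rewardReflLin Ω c ψ 0) = _
  rw [rewardReflLin_zero, h1, map_zero, add_zero, h0, map_sum]
  simp only [map_smul, mulOp_ket, sum_inner, inner_sum, inner_smul_left, inner_smul_right,
    inner_ket, hoff, Complex.conj_ofReal, mul_ite, mul_zero, mul_one, Finset.sum_ite_eq',
    Finset.mem_univ, if_true]
  have : mean P y - c = ∑ ω, (P ω).toReal * (y ω - c) := by
    simp only [mean, mul_sub, Finset.sum_sub_distrib, ← Finset.sum_mul, sum_pmf_toReal, one_mul]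
  rw [this, Complex.ofReal_sum]
  refine Finset.sum_congr rfl fun ω _ => ?_
  rw [← Complex.ofReal_mul, ← Complex.ofReal_mul]
  congr 1
  nth_rewrite 3 [← Real.mul_self_sqrt (ENNReal.toReal_nonneg (a := P ω))]
  ring

section Test
variable {Ω : Type} (ω₀ : Ω)

/-- `k` steps of the walk with the reward reflection, followed by `p`. -/
def walkProg (c : ℝ) : ℕ → Prog Ω (Fin 2) → Prog Ω (Fin 2)
  | 0, p => p
  | k + 1, p => .gate (rewardRefl Ω c) (.query true
      (.gate (ℂ ∙ startState ω₀).reflection (.query false (walkProg c k p))))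

/-- Prepare the state, make `k` steps of the walk and measure the reward reflection. -/
def testProg (c : ℝ) (k : ℕ) (next : Fin 2 → Prog Ω (Fin 2)) : Prog Ω (Fin 2) :=
  .restart (.query false (walkProg ω₀ c k
    (.measure 2 (reflMeas Ω c) (reflMeas_complete Ω c) next)))

lemma queries_walkProg (c : ℝ) (k : ℕ) (p : Prog Ω (Fin 2)) :
    (walkProg ω₀ c k p).queries = 2 * k + p.queries := by
  induction k with
  | zero => simp [walkProg]
  | succ k ih => simp only [walkProg, Prog.queries, ih]; ring

lemma queries_testProg (c : ℝ) (k q : ℕ) (next : Fin 2 → Prog Ω (Fin 2))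
    (h : ∀ i, (next i).queries ≤ q) : (testProg ω₀ c k next).queries ≤ 2 * k + 1 + q := by
  have : (Finset.univ.sup fun i => (next i).queries) ≤ q := Finset.sup_le fun i _ => h i
  simp only [testProg, Prog.queries, queries_walkProg]
  omega

/-- A program cannot contain the reflection in the unknown state `O|0⟩`, but it is the conjugate by
`O` of the reflection in the known initial state. This costs the two queries of a walk step. -/
lemma liftOracle_reflection (O : Reg Ω ≃ₗᵢ[ℂ] Reg Ω) (v : Joint Ω (Fin 2)) :
    liftOracle O ((ℂ ∙ startState ω₀).reflection ((liftOracle O).symm v)) =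
      (ℂ ∙ liftOracle O (startState ω₀)).reflection v := by
  rw [reflection_unit _ (norm_startState ω₀), reflection_unit _ (by
    rw [LinearIsometryEquiv.norm_map, norm_startState]), map_sub, map_smul,
    LinearIsometryEquiv.apply_symm_apply]
  congr 3
  rw [← LinearIsometryEquiv.inner_map_map (liftOracle O), LinearIsometryEquiv.apply_symm_apply]

lemma mass_walkProg (O : Reg Ω ≃ₗᵢ[ℂ] Reg Ω) (c : ℝ) (k m : ℕ) (p : Prog Ω (Fin 2)) (s : Set ℝ) :
    (walkProg ω₀ c k p).mass O (startState ω₀)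
      (walkState (rewardRefl Ω c) (liftOracle O (startState ω₀)) m) s =
    p.mass O (startState ω₀)
      (walkState (rewardRefl Ω c) (liftOracle O (startState ω₀)) (m + k)) s := by
  induction k generalizing m with
  | zero => rfl
  | succ k ih =>
    rw [show m + (k + 1) = m + 1 + k by ring, ← ih (m + 1), walkState, ← liftOracle_reflection]
    rfl

/-- The law of a test: with probability `(1 ± sin ((4 j + 1) t)) / 2` the program goes on with
`next 0` or `next 1`, where `sin t` is the difference between the mean and the level `c`. -/
lemma mass_testProg [Fintype Ω] {ω₀ : Ω} {O : Reg Ω ≃ₗᵢ[ℂ] Reg Ω} {P : PMF Ω}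
    {y : Ω → ℝ} (hy : ∀ ω, y ω ∈ Set.Icc (0 : ℝ) 1) (hO : Encodes ω₀ O P y) {c : ℝ}
    (hc : c ∈ Set.Icc (0 : ℝ) 1) {t : ℝ} (ht : Real.cos t ≠ 0) (hx : mean P y - c = Real.sin t)
    (j : ℕ) (next : Fin 2 → Prog Ω (Fin 2)) (hn : ∀ i, (next i).Fresh O (startState ω₀))
    (s : Set ℝ) :
    (testProg ω₀ c (2 * j) next).mass O (startState ω₀) (startState ω₀) s =
      ENNReal.ofReal ((1 + Real.sin ((4 * j + 1) * t)) / 2) *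
        (next 0).mass O (startState ω₀) (startState ω₀) s +
      ENNReal.ofReal ((1 - Real.sin ((4 * j + 1) * t)) / 2) *
        (next 1).mass O (startState ω₀) (startState ω₀) s := by
  set ψ := liftOracle O (startState ω₀) with hψ
  have hψ1 : ‖ψ‖ = 1 := by rw [hψ, LinearIsometryEquiv.norm_map, norm_startState]
  have h1 : (testProg ω₀ c (2 * j) next).mass O (startState ω₀) (startState ω₀) s =
      (Prog.measure 2 (reflMeas Ω c) (reflMeas_complete Ω c) next).mass O (startState ω₀)
        (walkState (rewardRefl Ω c) ψ (2 * j)) s := by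
    rw [testProg, Prog.mass_restart, norm_startState]
    have h := mass_walkProg ω₀ O c (2 * j) 0
      (.measure 2 (reflMeas Ω c) (reflMeas_complete Ω c) next) s
    rw [zero_add] at h
    rw [← h]
    simp only [one_pow, ENNReal.ofReal_one, one_mul]
    rfl
  have hsig := walkState_signal (rewardRefl_rewardRefl (Ω := Ω) c) (rewardRefl_symm c) hψ1 ht
    (by rw [inner_rewardRefl hy hO hc, hx]) j
  rw [h1, Prog.mass_measure, Fin.sum_univ_two, hn 0, hn 1, norm_reflMeas_sq, norm_reflMeas_sq,
    hsig, norm_walkState, hψ1]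
  simp [sub_eq_add_neg]

end Test

/-! ### Majority vote -/

/-- Repeat a test `n` times, starting with the balance `z` of the votes. -/
def voteProg {Ω : Type} (ω₀ : Ω) (c : ℝ) (k : ℕ) (next : ℤ → Prog Ω (Fin 2)) :
    ℕ → ℤ → Prog Ω (Fin 2)
  | 0, z => next z
  | n + 1, z => testProg ω₀ c k fun i => voteProg ω₀ c k next n (z + if i = 0 then 1 else -1)

lemma queries_voteProg {Ω : Type} (ω₀ : Ω) (c : ℝ) (k q : ℕ) (next : ℤ → Prog Ω (Fin 2))
    (h : ∀ z, (next z).queries ≤ q) (n : ℕ) (z : ℤ) :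
    (voteProg ω₀ c k next n z).queries ≤ n * (2 * k + 1) + q := by
  induction n generalizing z with
  | zero => simpa [voteProg] using h z
  | succ n ih =>
    refine (queries_testProg ω₀ c k _ _ fun i => ih _).trans (le_of_eq ?_)
    ring

/-- Every test begins with a restart, so successive votes behave as independent coin tosses whatever
state the measurement left behind. -/
lemma fresh_voteProg {Ω : Type} (ω₀ : Ω) (O : Reg Ω ≃ₗᵢ[ℂ] Reg Ω) (c : ℝ) (k : ℕ)
    (next : ℤ → Prog Ω (Fin 2)) (h : ∀ z, (next z).Fresh O (startState ω₀)) (n : ℕ) (z : ℤ) :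
    (voteProg ω₀ c k next n z).Fresh O (startState ω₀) := by
  cases n with
  | zero => exact h z
  | succ n => exact Prog.fresh_restart O _ (norm_startState ω₀) _

/-- If `g` contracts by the factor `M` in expectation at every vote and bounds the excess failure
probability after the votes, then `M ^ n * g` bounds it `n` votes earlier. -/
lemma mass_voteProg_le {Ω : Type} [Fintype Ω] {ω₀ : Ω} {O : Reg Ω ≃ₗᵢ[ℂ] Reg Ω} {P : PMF Ω}
    {y : Ω → ℝ} (hy : ∀ ω, y ω ∈ Set.Icc (0 : ℝ) 1) (hO : Encodes ω₀ O P y) {c : ℝ}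
    (hc : c ∈ Set.Icc (0 : ℝ) 1) {t : ℝ} (ht : Real.cos t ≠ 0) (hx : mean P y - c = Real.sin t)
    (j : ℕ) (next : ℤ → Prog Ω (Fin 2)) (hn : ∀ z, (next z).Fresh O (startState ω₀))
    (s : Set ℝ) {g : ℤ → ℝ} {M β : ℝ} (hM : 0 ≤ M) (hβ : 0 ≤ β) (hg : ∀ z, 0 ≤ g z)
    (hstep : ∀ z, (1 + Real.sin ((4 * j + 1) * t)) / 2 * g (z + 1) +
      (1 - Real.sin ((4 * j + 1) * t)) / 2 * g (z - 1) ≤ M * g z)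
    (hend : ∀ z, (next z).mass O (startState ω₀) (startState ω₀) s ≤ ENNReal.ofReal (β + g z))
    (n : ℕ) (z : ℤ) :
    (voteProg ω₀ c (2 * j) next n z).mass O (startState ω₀) (startState ω₀) s ≤
      ENNReal.ofReal (β + M ^ n * g z) := by
  induction n generalizing z with
  | zero => simpa [voteProg] using hend z
  | succ n ih =>
    rw [voteProg, mass_testProg hy hO hc ht hx j _ (fun i => fresh_voteProg ω₀ O c _ next hn _ _)]
    simp only [if_true, one_ne_zero, if_false, ← sub_eq_add_neg]
    have h1 := Real.neg_one_le_sin ((4 * j + 1) * t)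
    have h2 := Real.sin_le_one ((4 * j + 1) * t)
    calc _ ≤ ENNReal.ofReal ((1 + Real.sin ((4 * j + 1) * t)) / 2) *
          ENNReal.ofReal (β + M ^ n * g (z + 1)) +
        ENNReal.ofReal ((1 - Real.sin ((4 * j + 1) * t)) / 2) *
          ENNReal.ofReal (β + M ^ n * g (z - 1)) := by gcongr <;> exact ih _
      _ = ENNReal.ofReal (β + M ^ n * ((1 + Real.sin ((4 * j + 1) * t)) / 2 * g (z + 1) +
          (1 - Real.sin ((4 * j + 1) * t)) / 2 * g (z - 1))) := by
        have := hg (z + 1)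
        have := hg (z - 1)
        rw [← ENNReal.ofReal_mul (by linarith), ← ENNReal.ofReal_mul (by linarith),
          ← ENNReal.ofReal_add (mul_nonneg (by linarith) (by positivity))
            (mul_nonneg (by linarith) (by positivity))]
        congr 1
        ring
      _ ≤ ENNReal.ofReal (β + M ^ (n + 1) * g z) := by
        apply ENNReal.ofReal_le_ofReal
        rw [pow_succ, mul_assoc]
        gcongr
        exact hstep z

/-! ### Quantum Monte Carlo by a noisy ternary search -/

/-- The largest number `j` with `4 j + 1 ≤ 1 / w`. -/
def walkHalfLen (w : ℝ) : ℕ := ⌊(1 / w - 1) / 4⌋₊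

lemma walkHalfLen_le {w : ℝ} (hw : 0 < w) (hw1 : w ≤ 1 / 2) : 4 * (walkHalfLen w : ℝ) + 1 ≤ 1 / w := by
  have h2 : 2 ≤ 1 / w := by rw [le_div_iff₀ hw]; linarith
  have := Nat.floor_le (a := (1 / w - 1) / 4) (by linarith)
  unfold walkHalfLen
  linarith

/-- With `k = 4 j + 1`, rounding down gives `k ≥ 1 / w - 4`, and also `k ≥ 1`; together `5 k = k + 4
k ≥ 1 / w`. -/
lemma le_walkHalfLen {w : ℝ} (hw : 0 < w) : 1 / (5 * w) ≤ 4 * (walkHalfLen w : ℝ) + 1 := by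
  have h := Nat.lt_floor_add_one ((1 / w - 1) / 4)
  have h0 : (0 : ℝ) ≤ (walkHalfLen w : ℝ) := Nat.cast_nonneg _
  have h5 : 1 / (5 * w) = 1 / 5 * (1 / w) := by field_simp
  rw [h5]
  unfold walkHalfLen at *
  linarith

/-- Jordan's inequality gives `t ≤ (π / 2) w`, so the amplified angle does not pass `π / 2`. It is
at least `(1 / (5 w)) (w / 3) = 1 / 15`, and Jordan's inequality again gives a sine of at least `2 /
(15 π) ≥ 1 / 24`. -/
lemma sin_walkHalfLen {w t : ℝ} (hw : 0 < w) (hw1 : w ≤ 1 / 2) (ht0 : 0 ≤ t)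
    (ht1 : t ≤ Real.pi / 2) (h1 : w / 3 ≤ Real.sin t) (h2 : Real.sin t ≤ w) :
    1 / 24 ≤ Real.sin ((4 * walkHalfLen w + 1) * t) := by
  have hpi := Real.pi_pos
  have hs := Real.mul_le_sin ht0 ht1
  have hst := Real.sin_le ht0
  have hk1 := walkHalfLen_le hw hw1
  have hk2 := le_walkHalfLen hw
  set k : ℝ := 4 * (walkHalfLen w : ℝ) + 1
  have hk0 : 0 ≤ k := by positivity
  have htw : t ≤ Real.pi / 2 * w := by
    have : 2 / Real.pi * t ≤ w := hs.trans h2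
    calc t = Real.pi / 2 * (2 / Real.pi * t) := by field_simp
      _ ≤ _ := by gcongr
  have hkt : k * t ≤ Real.pi / 2 := by
    calc k * t ≤ 1 / w * (Real.pi / 2 * w) := by gcongr
      _ = _ := by field_simp
  refine le_trans ?_ (Real.mul_le_sin (by positivity) hkt)
  have hkt2 : 1 / 15 ≤ k * t := by
    calc (1 : ℝ) / 15 = 1 / (5 * w) * (w / 3) := by field_simp; norm_num
      _ ≤ k * t := by gcongr; linarith
  calc (1 : ℝ) / 24 ≤ 2 / Real.pi * (1 / 15) := by
        rw [div_mul_div_comm, div_le_div_iff₀ (by norm_num) (by positivity)]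
        linarith [Real.pi_lt_d2]
    _ ≤ _ := by gcongr

/-- The Chernoff step for a vote of bias `σ` with base `23 / 24`. The left side decreases in `σ`,
and at `σ = 1 / 24` it equals `575 / 1152 + 576 / 1152`. -/
lemma vote_contraction {σ : ℝ} (h : 1 / 24 ≤ σ) :
    (1 + σ) / 2 * (23 / 24) + (1 - σ) / 2 * (24 / 23) ≤ 1151 / 1152 := by
  linarith

lemma vote_contraction_pow (n : ℕ) : (1151 / 1152 : ℝ) ^ (1152 * n) ≤ (1 / 2) ^ n := by
  rw [pow_mul]
  gcongr
  have h : (1151 / 1152 : ℝ) ≤ Real.exp (-(1 / 1152)) := by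
    have := Real.one_sub_le_exp_neg (1 / 1152)
    linarith
  calc (1151 / 1152 : ℝ) ^ 1152 ≤ Real.exp (-(1 / 1152)) ^ 1152 := by gcongr
    _ = Real.exp (-1) := by rw [← Real.exp_nat_mul]; norm_num
    _ ≤ 1 / 2 := by linarith [Real.exp_neg_one_lt_d9]

/-- Search for the mean in `[c - w, c + w]`; each of the `i` rounds shrinks the interval by the
factor `2 / 3`, and `ℓ` controls the number of votes. -/
def searchProg {Ω : Type} (ω₀ : Ω) (ℓ : ℕ) : ℕ → ℝ → ℝ → Prog Ω (Fin 2)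
  | 0, c, _ => .halt c
  | i + 1, c, w => voteProg ω₀ c (2 * walkHalfLen w)
      (fun z => searchProg ω₀ ℓ i (if 0 < z then c + w / 3 else c - w / 3) (2 * w / 3))
      (1152 * (ℓ + i + 1)) 0

lemma fresh_searchProg {Ω : Type} (ω₀ : Ω) (O : Reg Ω ≃ₗᵢ[ℂ] Reg Ω) (ℓ i : ℕ) (c w : ℝ) :
    (searchProg ω₀ ℓ i c w).Fresh O (startState ω₀) := by
  induction i generalizing c w with
  | zero => exact Prog.fresh_halt O _ (norm_startState ω₀) c
  | succ i ih => exact fresh_voteProg ω₀ O c _ _ (fun z => ih _ _) _ _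

/-- A test costs `4 j + 1 ≤ 1 / w` queries and `ℓ + i + 1 ≤ ℓ (i + 2)`. Relative to the final
half-width the rounds sum to `∑ (k + 1) (2 / 3) ^ k` over `1 ≤ k ≤ i`, which is `8 - (2 i + 8) (2 /
3) ^ i`; the exact partial sum is what lets the induction close. -/
lemma queries_searchProg {Ω : Type} (ω₀ : Ω) {ℓ : ℕ} (hℓ : 1 ≤ ℓ) (i : ℕ) (c : ℝ) {w : ℝ}
    (hw : 0 < w) (hw1 : w ≤ 1 / 2) :
    ((searchProg ω₀ ℓ i c w).queries : ℝ) ≤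
      1152 * ℓ / (w * (2 / 3) ^ i) * (8 - (2 * i + 8) * (2 / 3) ^ i) := by
  induction i generalizing c w with
  | zero => simp [searchProg, Prog.queries]
  | succ i ih =>
    have hw' : 0 < 2 * w / 3 := by positivity
    set b : ℝ := 1152 * ℓ / (w * (2 / 3) ^ (i + 1)) * (8 - (2 * i + 8) * (2 / 3) ^ i) with hb
    have hnext : ∀ z : ℤ, (searchProg ω₀ ℓ i (if 0 < z then c + w / 3 else c - w / 3)
        (2 * w / 3)).queries ≤ ⌊b⌋₊ := fun z => by
      apply Nat.le_floor
      refine (ih _ hw' (by linarith)).trans (le_of_eq ?_)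
      rw [hb, pow_succ]
      congr 2
      ring
    have hb0 : 0 ≤ b := (Nat.cast_nonneg _).trans
      ((ih c hw' (by linarith)).trans (le_of_eq (by rw [hb, pow_succ]; congr 2; ring)))
    have h := queries_voteProg ω₀ c (2 * walkHalfLen w) ⌊b⌋₊ _ hnext (1152 * (ℓ + i + 1)) 0
    have h' : ((searchProg ω₀ ℓ (i + 1) c w).queries : ℝ) ≤
        ((1152 * (ℓ + i + 1) * (2 * (2 * walkHalfLen w) + 1) + ⌊b⌋₊ : ℕ) : ℝ) := by
      exact_mod_cast h
    refine h'.trans ?_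
    push_cast
    have hk := walkHalfLen_le hw hw1
    have hℓ' : (1 : ℝ) ≤ ℓ := by exact_mod_cast hℓ
    calc 1152 * ((ℓ : ℝ) + i + 1) * (2 * (2 * walkHalfLen w) + 1) + (⌊b⌋₊ : ℝ)
        ≤ 1152 * (ℓ * (i + 2)) * (1 / w) + b := by
          have hi : (0 : ℝ) ≤ i := Nat.cast_nonneg i
          gcongr
          · nlinarith
          · linarith
          · exact Nat.floor_le hb0
      _ = 1152 * ℓ / (w * (2 / 3) ^ (i + 1)) *
          (8 - (2 * ((i : ℝ) + 1) + 8) * (2 / 3) ^ (i + 1)) := by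
          have hp : (2 / 3 : ℝ) ^ (i + 1) ≠ 0 := by positivity
          have hq : (2 / 3 : ℝ) ^ i = 3 / 2 * (2 / 3) ^ (i + 1) := by rw [pow_succ]; ring
          rw [hb, hq]
          generalize (2 / 3 : ℝ) ^ (i + 1) = x at hp
          field_simp
          ring

/-- A wrong vote with `i` rounds left after it has probability at most `2 ^ (-(ℓ + i + 1)) ≤ δ 2 ^
(-(i + 1))`, and these bounds add up to `δ (1 - 2 ^ (-i))`. The interval `[c - w, c + w]` stays
inside `[0,1]`, which keeps all later levels admissible. -/
lemma mass_searchProg_le {Ω : Type} [Fintype Ω] {ω₀ : Ω} {O : Reg Ω ≃ₗᵢ[ℂ] Reg Ω} {P : PMF Ω}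
    {y : Ω → ℝ} (hy : ∀ ω, y ω ∈ Set.Icc (0 : ℝ) 1) (hO : Encodes ω₀ O P y) {ε δ : ℝ}
    (hδ : 0 ≤ δ) {ℓ : ℕ} (hℓ : (1 / 2) ^ ℓ ≤ δ) (i : ℕ) {c w : ℝ} (hw : 0 < w) (hw1 : w ≤ 1 / 2)
    (hc0 : 0 ≤ c - w) (hc1 : c + w ≤ 1) (hp : |mean P y - c| ≤ w) (hε : w * (2 / 3) ^ i < ε) :
    (searchProg ω₀ ℓ i c w).mass O (startState ω₀) (startState ω₀) {r | ε ≤ |r - mean P y|} ≤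
      ENNReal.ofReal (δ * (1 - (1 / 2) ^ i)) := by
  classical
  induction i generalizing c w with
  | zero =>
    rw [searchProg, Prog.mass_halt, if_neg]
    · exact zero_le
    · rw [Set.mem_ofPred_eq, abs_sub_comm, not_le]
      simp only [pow_zero, mul_one] at hε
      linarith
  | succ i ih =>
    have hpow : ((1 : ℝ) / 2) ^ i ≤ 1 := pow_le_one₀ (by norm_num) (by norm_num)
    have hβ : 0 ≤ δ * (1 - (1 / 2) ^ i) := mul_nonneg hδ (by linarith)
    rw [abs_le] at hp
    have hε' : 2 * w / 3 * (2 / 3) ^ i < ε := by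
      rw [pow_succ] at hε
      linarith
    have hplus : -(w / 3) ≤ mean P y - c →
        (searchProg ω₀ ℓ i (c + w / 3) (2 * w / 3)).mass O (startState ω₀) (startState ω₀)
          {r | ε ≤ |r - mean P y|} ≤ ENNReal.ofReal (δ * (1 - (1 / 2) ^ i)) := fun h =>
      ih (by positivity) (by linarith) (by linarith) (by linarith)
        (abs_le.mpr ⟨by linarith, by linarith⟩) hε'
    have hminus : mean P y - c ≤ w / 3 →
        (searchProg ω₀ ℓ i (c - w / 3) (2 * w / 3)).mass O (startState ω₀) (startState ω₀)
          {r | ε ≤ |r - mean P y|} ≤ ENNReal.ofReal (δ * (1 - (1 / 2) ^ i)) := fun h =>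
      ih (by positivity) (by linarith) (by linarith) (by linarith)
        (abs_le.mpr ⟨by linarith, by linarith⟩) hε'
    have hle1 : ∀ p : Prog Ω (Fin 2), p.mass O (startState ω₀) (startState ω₀)
        {r | ε ≤ |r - mean P y|} ≤ ENNReal.ofReal 1 := fun p => by
      have := p.mass_le O (startState ω₀) (norm_startState ω₀) (startState ω₀)
        {r | ε ≤ |r - mean P y|}
      rwa [norm_startState, one_pow] at this
    have hsin : Real.sin (Real.arcsin (mean P y - c)) = mean P y - c :=
      Real.sin_arcsin (by linarith) (by linarith)
    -- The distance from the mean to the level is at most `w ≤ 1 / 2`, so the sine is not `±1`.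
    have hcos : Real.cos (Real.arcsin (mean P y - c)) ≠ 0 := by
      rw [Real.cos_arcsin]
      exact (Real.sqrt_pos.mpr (by nlinarith)).ne'
    set t := Real.arcsin (mean P y - c)
    set next : ℤ → Prog Ω (Fin 2) := fun z =>
      searchProg ω₀ ℓ i (if 0 < z then c + w / 3 else c - w / 3) (2 * w / 3) with hnext
    have hvote := @mass_voteProg_le Ω _ ω₀ O P y hy hO c ⟨by linarith, by linarith⟩ t hcos hsin.symm
      (walkHalfLen w) next (fun z => fresh_searchProg ω₀ O ℓ i _ _) {r | ε ≤ |r - mean P y|}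
    have hfinal : ∀ g : ℤ → ℝ, g 0 ≤ 1 → (0 ≤ g 0) →
        δ * (1 - (1 / 2) ^ i) + (1151 / 1152 : ℝ) ^ (1152 * (ℓ + i + 1)) * g 0 ≤
          δ * (1 - (1 / 2) ^ (i + 1)) := fun g hg hg0 => by
      have h1 := vote_contraction_pow (ℓ + i + 1)
      have h2 : (1 / 2 : ℝ) ^ (ℓ + i + 1) ≤ δ * (1 / 2) ^ (i + 1) := by
        rw [add_assoc, pow_add]
        gcongr
      have h3 : (1151 / 1152 : ℝ) ^ (1152 * (ℓ + i + 1)) * g 0 ≤ δ * (1 / 2) ^ (i + 1) :=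
        (mul_le_of_le_one_right (by positivity) hg).trans (h1.trans h2)
      generalize (1151 / 1152 : ℝ) ^ (1152 * (ℓ + i + 1)) * g 0 = r at h3 ⊢
      rw [pow_succ] at h3 ⊢
      linarith
    have hnextz : ∀ z, next z =
        searchProg ω₀ ℓ i (if 0 < z then c + w / 3 else c - w / 3) (2 * w / 3) := fun z => rfl
    -- In the upper or lower third the vote is biased. There `g` is an exponential of the balance
    -- that is `1` at the start and at least `1` at every wrong verdict, ties included.
    rcases le_or_gt (w / 3) (mean P y - c) with hx | hx
    · have hσ : 1 / 24 ≤ Real.sin ((4 * walkHalfLen w + 1) * t) := by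
        refine sin_walkHalfLen hw hw1 ?_ (Real.arcsin_le_pi_div_two _) ?_ ?_
        · exact Real.arcsin_nonneg.mpr (by linarith)
        · rw [hsin]; exact hx
        · rw [hsin]; exact hp.2
      refine (hvote (g := fun z => (23 / 24 : ℝ) ^ z) (M := 1151 / 1152) (by norm_num) hβ
        (fun z => by positivity) (fun z => ?_) (fun z => ?_) _ 0).trans
        (ENNReal.ofReal_le_ofReal (hfinal (fun z => (23 / 24 : ℝ) ^ z) (by simp) (by simp)))
      · rw [zpow_add₀ (by norm_num), zpow_sub₀ (by norm_num)]
        have h := mul_le_mul_of_nonneg_right (vote_contraction hσ)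
          (by positivity : (0 : ℝ) ≤ (23 / 24) ^ z)
        calc _ = _ := by ring
          _ ≤ _ := h
      · rw [hnextz]
        split_ifs with hz
        · exact (hplus (by linarith)).trans (ENNReal.ofReal_le_ofReal
            (le_add_of_nonneg_right (by positivity)))
        · refine (hle1 _).trans (ENNReal.ofReal_le_ofReal (le_add_of_nonneg_of_le hβ ?_))
          exact one_le_zpow_of_nonpos₀ (by norm_num) (by norm_num) (by omega)
    · rcases le_or_gt (mean P y - c) (-(w / 3)) with hx' | hx'
      · have hσ : 1 / 24 ≤ Real.sin ((4 * walkHalfLen w + 1) * (-t)) := by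
          refine sin_walkHalfLen hw hw1 ?_ ?_ ?_ ?_
          · exact neg_nonneg.mpr (Real.arcsin_nonpos.mpr (by linarith))
          · linarith [Real.neg_pi_div_two_le_arcsin (mean P y - c)]
          · rw [Real.sin_neg, hsin]; linarith
          · rw [Real.sin_neg, hsin]; linarith
        rw [mul_neg, Real.sin_neg] at hσ
        refine (hvote (g := fun z => (24 / 23 : ℝ) ^ z) (M := 1151 / 1152) (by norm_num) hβ
          (fun z => by positivity) (fun z => ?_) (fun z => ?_) _ 0).trans
          (ENNReal.ofReal_le_ofReal (hfinal (fun z => (24 / 23 : ℝ) ^ z) (by simp) (by simp)))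
        · rw [zpow_add₀ (by norm_num), zpow_sub₀ (by norm_num)]
          have h := mul_le_mul_of_nonneg_right (vote_contraction hσ)
            (by positivity : (0 : ℝ) ≤ (24 / 23) ^ z)
          calc _ = _ := by ring
            _ ≤ _ := h
        · rw [hnextz]
          split_ifs with hz
          · refine (hle1 _).trans (ENNReal.ofReal_le_ofReal (le_add_of_nonneg_of_le hβ ?_))
            exact one_le_zpow₀ (by norm_num) hz.le
          · exact (hminus (by linarith)).trans (ENNReal.ofReal_le_ofReal
              (le_add_of_nonneg_right (by positivity)))
      -- In the middle third both verdicts keep the mean in the new interval, so the vote needs no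
      -- bias and adds no failure.
      · refine (hvote (g := fun _ => 0) (M := 1151 / 1152) (by norm_num) hβ
          (fun z => le_rfl) (fun z => by simp) (fun z => ?_) _ 0).trans
          (ENNReal.ofReal_le_ofReal (hfinal (fun _ => 0) (by simp) (by simp)))
        rw [hnextz, add_zero]
        split_ifs with hz
        · exact hplus hx'.le
        · exact hminus hx.le

/-- The least number of rounds of the search that reaches an accuracy below `ε`. -/
def searchRounds (ε : ℝ) : ℕ := sInf {i | 1 / 2 * (2 / 3 : ℝ) ^ i < ε}

/-- The quantum Monte Carlo method given by the search. -/
def searchAlg {Ω : Type} (ω₀ : Ω) (ε δ : ℝ) : QAlg Ω where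
  W := Fin 2
  w₀ := 0
  prog := searchProg ω₀ ⌈Real.logb 2 (1 / δ)⌉₊ (searchRounds ε) (1 / 2) (1 / 2)

lemma init_searchAlg {Ω : Type} (ω₀ : Ω) (ε δ : ℝ) :
    (searchAlg ω₀ ε δ).init ω₀ = startState ω₀ := by
  unfold QAlg.init startState
  dsimp only [searchAlg]
  congr 1
  exact Subsingleton.elim _ _

lemma searchRounds_spec {ε : ℝ} (hε : 0 < ε) : 1 / 2 * (2 / 3 : ℝ) ^ searchRounds ε < ε := by
  have hne : {i | 1 / 2 * (2 / 3 : ℝ) ^ i < ε}.Nonempty := by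
    obtain ⟨n, hn⟩ := exists_pow_lt_of_lt_one hε (by norm_num : (2 / 3 : ℝ) < 1)
    exact ⟨n, by have : (0 : ℝ) < (2 / 3) ^ n := by positivity
                 simp only [Set.mem_ofPred_eq]; linarith⟩
  exact Nat.sInf_mem hne

lemma isQMC_searchAlg {Ω : Type} [Fintype Ω] (ω₀ : Ω) : IsQMC ω₀ 27648 (searchAlg ω₀) where
  queries_le ε δ hε hδ hδ2 := by
    have hlog : 1 ≤ Real.logb 2 (1 / δ) := by
      rw [Real.le_logb_iff_rpow_le (by norm_num) (by positivity), Real.rpow_one,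
        le_div_iff₀ hδ]
      linarith
    have hℓ : 1 ≤ ⌈Real.logb 2 (1 / δ)⌉₊ := Nat.one_le_ceil_iff.mpr (by linarith)
    have hℓ2 : (⌈Real.logb 2 (1 / δ)⌉₊ : ℝ) ≤ 2 * Real.logb 2 (1 / δ) := by
      have := Nat.ceil_lt_add_one (a := Real.logb 2 (1 / δ)) (by linarith)
      linarith
    change ((searchProg ω₀ _ (searchRounds ε) (1 / 2) (1 / 2)).queries : ℝ) ≤ _
    rcases hJ : searchRounds ε with _ | J
    · simp only [searchProg, Prog.queries, Nat.cast_zero]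
      positivity
    -- Minimality of the number of rounds: the search does not overshoot, so its final half-width is
    -- at least `2 ε / 3`. With `ℓ ≤ 2 log (1 / δ)` this gives the constant `1152 · 2 · (3 / 2) · 8
    -- = 27648`.
    · have hlow : ε ≤ 1 / 2 * (2 / 3 : ℝ) ^ J := by
        have : J ∉ {i | 1 / 2 * (2 / 3 : ℝ) ^ i < ε} :=
          Nat.notMem_of_lt_sInf (by change J < searchRounds ε; omega)
        simpa using this
      refine (queries_searchProg ω₀ hℓ (J + 1) (1 / 2) (by norm_num) le_rfl).trans ?_
      have h23 : 2 / 3 * ε ≤ 1 / 2 * (2 / 3 : ℝ) ^ (J + 1) := by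
        rw [pow_succ]; linarith
      calc _ ≤ 1152 * (2 * Real.logb 2 (1 / δ)) / (2 / 3 * ε) * 8 := by
            have : (0 : ℝ) ≤ (2 * ((J + 1 : ℕ) : ℝ) + 8) * (2 / 3) ^ (J + 1) := by positivity
            have h8 : 8 - (2 * ((J + 1 : ℕ) : ℝ) + 8) * (2 / 3) ^ (J + 1) ≤ 8 := by linarith
            refine (mul_le_mul_of_nonneg_left h8 (by positivity)).trans ?_
            gcongr
        _ = 27648 / ε * Real.logb 2 (1 / δ) := by field_simp; norm_num
  accurate ε δ hε hδ hδ2 P y O hy hO := by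
    have hℓ : (1 / 2 : ℝ) ^ ⌈Real.logb 2 (1 / δ)⌉₊ ≤ δ := by
      have h1 := Nat.le_ceil (Real.logb 2 (1 / δ))
      rw [Real.logb_le_iff_le_rpow (by norm_num) (by positivity), Real.rpow_natCast] at h1
      rw [one_div, inv_pow]
      refine inv_le_of_inv_le₀ hδ ?_
      rwa [← one_div]
    obtain ⟨hmean0, hmean1⟩ := mean_mem_Icc P hy
    have h := mass_searchProg_le hy hO hδ.le hℓ (searchRounds ε) (c := 1 / 2) (w := 1 / 2)
      (by norm_num) le_rfl (by norm_num) (by norm_num)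
      (abs_le.mpr ⟨by linarith, by linarith⟩) (searchRounds_spec hε)
    rw [PMF.toOuterMeasure_apply]
    change (searchAlg ω₀ ε δ).prog.mass O ((searchAlg ω₀ ε δ).init ω₀)
      ((searchAlg ω₀ ε δ).init ω₀) _ ≤ _
    rw [init_searchAlg]
    refine le_trans h (ENNReal.ofReal_le_ofReal (mul_le_of_le_one_right hδ.le ?_))
    have : (0 : ℝ) < (1 / 2) ^ searchRounds ε := by positivity
    linarith

/-! ### Weighted norms and the design matrices -/

section LinearAlgebra
variable {d : ℕ}

lemma inner_eq_dotProduct (x z : Vec d) : ⟪x, z⟫_ℝ = x.ofLp ⬝ᵥ z.ofLp := by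
  rw [EuclideanSpace.inner_eq_star_dotProduct, star_trivial, dotProduct_comm]

lemma norm_sq_eq_dotProduct (x : Vec d) : ‖x‖ ^ 2 = x.ofLp ⬝ᵥ x.ofLp := by
  rw [← real_inner_self_eq_norm_sq, inner_eq_dotProduct]

lemma vecMulVec_mulVec_real (u z : Fin d → ℝ) :
    Matrix.vecMulVec u u *ᵥ z = (u ⬝ᵥ z) • u := by
  rw [Matrix.vecMulVec_mulVec]
  ext i
  simp [mul_comm]

lemma dotProduct_mulVec_comm {M : Matrix (Fin d) (Fin d) ℝ} (hM : M.IsHermitian)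
    (u z : Fin d → ℝ) : u ⬝ᵥ (M *ᵥ z) = (M *ᵥ u) ⬝ᵥ z := by
  have hT : Mᵀ = M := by simpa [Matrix.IsHermitian] using hM
  rw [Matrix.dotProduct_mulVec, ← Matrix.mulVec_transpose, hT]

lemma posSemidef_dotProduct_nonneg {M : Matrix (Fin d) (Fin d) ℝ} (hM : M.PosSemidef)
    (z : Fin d → ℝ) : 0 ≤ z ⬝ᵥ (M *ᵥ z) := by
  simpa using hM.dotProduct_mulVec_nonneg z

lemma wnorm_sq {M : Matrix (Fin d) (Fin d) ℝ} (hM : M.PosSemidef) (x : Vec d) :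
    wnorm M x ^ 2 = x.ofLp ⬝ᵥ (M *ᵥ x.ofLp) :=
  Real.sq_sqrt (posSemidef_dotProduct_nonneg hM _)

lemma wnorm_nonneg (M : Matrix (Fin d) (Fin d) ℝ) (x : Vec d) : 0 ≤ wnorm M x :=
  Real.sqrt_nonneg _

lemma wnorm_pos {M : Matrix (Fin d) (Fin d) ℝ} (hM : M.PosDef) {x : Vec d} (hx : x ≠ 0) :
    0 < wnorm M x := by
  have hx' : x.ofLp ≠ 0 := fun h => hx (by ext i; simp [h])
  have h := hM.dotProduct_mulVec_pos hx'
  exact Real.sqrt_pos.mpr (by simpa using h)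

/-- The Cauchy–Schwarz inequality for a positive definite form and its dual. -/
lemma abs_inner_le_wnorm_mul {M : Matrix (Fin d) (Fin d) ℝ} (hM : M.PosDef) (x z : Vec d) :
    |⟪x, z⟫_ℝ| ≤ wnorm M⁻¹ x * wnorm M z := by
  set u : Fin d → ℝ := M⁻¹ *ᵥ x.ofLp with hu
  have hxu : M *ᵥ u = x.ofLp := by
    rw [hu, Matrix.mulVec_mulVec, Matrix.mul_nonsing_inv _ hM.det_pos.ne'.isUnit,
      Matrix.one_mulVec]
  have ha : wnorm M⁻¹ x ^ 2 = u ⬝ᵥ (M *ᵥ u) := by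
    rw [wnorm_sq hM.inv.posSemidef, hxu, dotProduct_comm]
  have hb : ⟪x, z⟫_ℝ = u ⬝ᵥ (M *ᵥ z.ofLp) := by
    rw [inner_eq_dotProduct, ← hxu, dotProduct_mulVec_comm hM.isHermitian]
  -- This is the form `M` evaluated at `t u + z` with `u = M⁻¹ x`; its discriminant cannot be
  -- positive.
  have hquad : ∀ t : ℝ, 0 ≤ (wnorm M⁻¹ x ^ 2) * (t * t) + (2 * ⟪x, z⟫_ℝ) * t + wnorm M z ^ 2 := by
    intro t
    have h := posSemidef_dotProduct_nonneg hM.posSemidef (t • u + z.ofLp)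
    have hsym : z.ofLp ⬝ᵥ (M *ᵥ u) = u ⬝ᵥ (M *ᵥ z.ofLp) := by
      rw [dotProduct_mulVec_comm hM.isHermitian, dotProduct_comm]
    rw [Matrix.mulVec_add, Matrix.mulVec_smul] at h
    simp only [add_dotProduct, dotProduct_add, smul_dotProduct, dotProduct_smul, smul_eq_mul,
      hsym] at h
    rw [ha, hb, wnorm_sq hM.posSemidef]
    linarith
  have hdisc := discrim_le_zero hquad
  rw [discrim] at hdisc
  apply abs_le_of_sq_le_sq _ (mul_nonneg (wnorm_nonneg _ _) (wnorm_nonneg _ _))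
  rw [mul_pow]
  linarith

lemma posDef_V {lam : ℝ} (hlam : 0 < lam) (h : Hist d) : (V lam h).PosDef := by
  induction h with
  | nil => exact Matrix.PosDef.one.smul hlam
  | cons p h ih =>
    refine ih.add_posSemidef (Matrix.PosSemidef.smul ?_ (by positivity))
    simpa using Matrix.posSemidef_vecMulVec_self_star p.1.ofLp

lemma eps_pos {lam : ℝ} (hlam : 0 < lam) (h : Hist d) {x : Vec d} (hx : x ≠ 0) :
    0 < eps lam h x := wnorm_pos (posDef_V hlam h).inv hx

/-- By the matrix determinant lemma the update multiplies the determinant by `1 + ε⁻² xᵀ V⁻¹ x`, and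
`ε² = xᵀ V⁻¹ x`. -/
lemma det_V_cons {lam : ℝ} (hlam : 0 < lam) (h : Hist d) {x : Vec d} (y : ℝ) (hx : x ≠ 0) :
    (V lam ((x, y) :: h)).det = 2 * (V lam h).det := by
  have hV := posDef_V hlam h
  have hpos := eps_pos hlam h hx
  have hsq : eps lam h x ^ 2 = x.ofLp ⬝ᵥ ((V lam h)⁻¹ *ᵥ x.ofLp) := wnorm_sq hV.inv.posSemidef x
  have hdecomp : V lam ((x, y) :: h) = V lam h +
      Matrix.replicateCol Unit ((1 / eps lam h x ^ 2) • x.ofLp) *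
        Matrix.replicateRow Unit x.ofLp := by
    rw [← Matrix.vecMulVec_eq, Matrix.smul_vecMulVec]
    rfl
  rw [hdecomp, Matrix.det_add_replicateCol_mul_replicateRow hV.det_pos.ne'.isUnit,
    Matrix.det_unique (n := Unit), Matrix.add_apply, Matrix.one_apply_eq, Matrix.mul_assoc,
    ← Matrix.replicateCol_mulVec, Matrix.replicateRow_mul_replicateCol_apply,
    Matrix.mulVec_smul, dotProduct_smul, ← hsq, smul_eq_mul, one_div,
    inv_mul_cancel₀ (pow_pos hpos 2).ne']
  ring

/-! ### Accurate histories: number of stages and confidence region -/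

/-- The histories in which all actions are nonzero of norm at most `L` and all estimates have the
prescribed accuracy with respect to the parameter `θ`. -/
def Accurate (lam L : ℝ) (θ : Vec d) : Hist d → Prop
  | [] => True
  | (x, y) :: h => x ≠ 0 ∧ ‖x‖ ≤ L ∧ |y - ⟪x, θ⟫_ℝ| ≤ eps lam h x ∧ Accurate lam L θ h

/-- The sum of the inverse accuracies. -/
def sumInvEps (lam : ℝ) : Hist d → ℝ
  | [] => 0
  | (x, _) :: h => 1 / eps lam h x + sumInvEps lam h

lemma sumInvEps_nonneg (lam : ℝ) (h : Hist d) : 0 ≤ sumInvEps lam h := by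
  induction h with
  | nil => exact le_rfl
  | cons p h ih =>
    have : 0 ≤ eps lam h p.1 := wnorm_nonneg _ _
    exact add_nonneg (by positivity) ih

lemma Accurate.det_V {lam L : ℝ} (hlam : 0 < lam) {θ : Vec d} {h : Hist d}
    (hh : Accurate lam L θ h) : (V lam h).det = 2 ^ h.length * lam ^ d := by
  induction h with
  | nil => simp [V]
  | cons p h ih =>
    obtain ⟨x, y⟩ := p
    rw [det_V_cons hlam h y hh.1, ih hh.2.2.2, List.length_cons]
    ring

/-- A stage adds `‖x‖² / ε² ≤ L² / ε²`, and a sum of squares of nonnegative numbers is at most the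
square of their sum. The sum of the `1 / ε` is the quantity controlled by the number of rounds. -/
lemma Accurate.trace_V_le {lam L : ℝ} {θ : Vec d} {h : Hist d}
    (hh : Accurate lam L θ h) : (V lam h).trace ≤ d * lam + L ^ 2 * sumInvEps lam h ^ 2 := by
  induction h with
  | nil => simp [V, sumInvEps, Matrix.trace_smul, mul_comm]
  | cons p h ih =>
    obtain ⟨x, y⟩ := p
    have ih' := ih hh.2.2.2
    have hx : ‖x‖ ^ 2 ≤ L ^ 2 := pow_le_pow_left₀ (norm_nonneg _) hh.2.1 2
    have he : 0 ≤ 1 / eps lam h x := by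
      have : 0 ≤ eps lam h x := wnorm_nonneg _ _
      positivity
    have hs := sumInvEps_nonneg lam h
    have htr : (V lam ((x, y) :: h)).trace = (V lam h).trace + (1 / eps lam h x) ^ 2 * ‖x‖ ^ 2 := by
      rw [norm_sq_eq_dotProduct, div_pow, one_pow]
      simp only [V, Matrix.trace_add, Matrix.trace_smul, Matrix.trace_vecMulVec, smul_eq_mul]
      rfl
    rw [htr]
    simp only [sumInvEps]
    have h1 : (1 / eps lam h x) ^ 2 * ‖x‖ ^ 2 ≤ (1 / eps lam h x) ^ 2 * L ^ 2 := by gcongr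
    have h2 : 0 ≤ L ^ 2 * (2 * (1 / eps lam h x) * sumInvEps lam h) := by positivity
    nlinarith

/-- The determinant of a positive semidefinite matrix is at most the `d`-th power of the mean of
its eigenvalues. -/
lemma det_le_trace_div_pow (hd : 1 ≤ d) {M : Matrix (Fin d) (Fin d) ℝ} (hM : M.PosSemidef) :
    M.det ≤ (M.trace / d) ^ d := by
  have hd' : (0 : ℝ) < d := by exact_mod_cast hd
  have h := Real.geom_mean_le_arith_mean_weighted Finset.univ (fun _ : Fin d => (1 / d : ℝ))
    hM.isHermitian.eigenvalues (fun _ _ => by positivity)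
    (by simp [hd'.ne']) (fun i _ => hM.eigenvalues_nonneg i)
  have hdet := hM.isHermitian.det_eq_prod_eigenvalues
  have htr := hM.isHermitian.trace_eq_sum_eigenvalues
  simp only [RCLike.ofReal_real_eq_id, id_eq] at hdet htr
  have hprod : 0 ≤ ∏ i, hM.isHermitian.eigenvalues i :=
    Finset.prod_nonneg fun i _ => hM.eigenvalues_nonneg i
  rw [Real.finsetProd_rpow _ _ (fun i _ => hM.eigenvalues_nonneg i), ← Finset.mul_sum, ← hdet,
    ← htr] at h
  rw [← hdet] at hprod
  calc M.det = (M.det ^ (1 / d : ℝ)) ^ d := by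
        rw [← Real.rpow_natCast, ← Real.rpow_mul hprod, one_div_mul_cancel hd'.ne', Real.rpow_one]
    _ ≤ (M.trace / d) ^ d := by
        gcongr
        rwa [div_eq_inv_mul M.trace, ← one_div]

/-- The number of completed stages is at most `numStages`. -/
lemma Accurate.length_le {lam L : ℝ} (hlam : 0 < lam) (hd : 1 ≤ d) {θ : Vec d} {h : Hist d}
    (hh : Accurate lam L θ h) {T : ℕ} (hT : sumInvEps lam h ≤ T) :
    (h.length : ℝ) ≤ numStages d L lam T := by
  have hd' : (0 : ℝ) < d := by exact_mod_cast hd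
  have hpsd := (posDef_V hlam h).posSemidef
  have h1 := det_le_trace_div_pow hd hpsd
  have h2 := hh.trace_V_le
  have h0 := sumInvEps_nonneg lam h
  have htr0 : 0 ≤ (V lam h).trace := hpsd.trace_nonneg
  rw [hh.det_V hlam] at h1
  have hle : (V lam h).trace / d ≤ lam * (L ^ 2 * T ^ 2 / (d * lam) + 1) := by
    rw [div_le_iff₀ hd']
    have : lam * (L ^ 2 * T ^ 2 / (d * lam) + 1) * d = d * lam + L ^ 2 * T ^ 2 := by
      field_simp
      ring
    rw [this]
    refine h2.trans ?_
    gcongr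
  -- The exact value of the determinant against its bound by the trace; cancelling `lam ^ d` and
  -- taking logarithms bounds the length.
  have h3 : (2 : ℝ) ^ h.length * lam ^ d ≤ (L ^ 2 * T ^ 2 / (d * lam) + 1) ^ d * lam ^ d := by
    refine h1.trans ?_
    rw [← mul_pow, mul_comm _ lam]
    gcongr
  have h4 := le_of_mul_le_mul_right h3 (by positivity)
  have hpos : 0 < L ^ 2 * (T : ℝ) ^ 2 / (d * lam) + 1 := by positivity
  rw [numStages, ← Real.logb_pow, Real.le_logb_iff_rpow_le (by norm_num) (by positivity),
    Real.rpow_natCast]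
  exact h4

/-- The residual of the true parameter, tested against a vector `z`. -/
lemma Accurate.residual_sq_le {lam L S : ℝ} (hlam : 0 < lam) {θ : Vec d} (hθ : ‖θ‖ ≤ S)
    {h : Hist d} (hh : Accurate lam L θ h) (z : Vec d) :
    (z.ofLp ⬝ᵥ (V lam h *ᵥ θ.ofLp - XWY lam h)) ^ 2 ≤
      (lam * S ^ 2 + h.length) * (z.ofLp ⬝ᵥ (V lam h *ᵥ z.ofLp)) := by
  induction h with
  | nil =>
    simp only [V, XWY, sub_zero, Matrix.smul_mulVec, Matrix.one_mulVec, dotProduct_smul,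
      smul_eq_mul, List.length_nil, Nat.cast_zero, add_zero, ← norm_sq_eq_dotProduct,
      ← inner_eq_dotProduct]
    have h1 := real_inner_mul_inner_self_le z θ
    rw [real_inner_self_eq_norm_sq, real_inner_self_eq_norm_sq] at h1
    have h2 : ‖θ‖ ^ 2 ≤ S ^ 2 := pow_le_pow_left₀ (norm_nonneg _) hθ 2
    have h3 : ‖z‖ ^ 2 * ‖θ‖ ^ 2 ≤ ‖z‖ ^ 2 * S ^ 2 := by gcongr
    have h4 := mul_le_mul_of_nonneg_left (h1.trans h3) (sq_nonneg lam)
    linarith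
  | cons p h ih =>
    obtain ⟨x, y⟩ := p
    have ih' := ih hh.2.2.2
    have hε := eps_pos hlam h hh.1
    have hQ := posSemidef_dotProduct_nonneg (posDef_V hlam h).posSemidef z.ofLp
    set ε := eps lam h x with hεdef
    set A := z.ofLp ⬝ᵥ (V lam h *ᵥ θ.ofLp - XWY lam h) with hA
    set Q := z.ofLp ⬝ᵥ (V lam h *ᵥ z.ofLp) with hQdef
    set a := (z.ofLp ⬝ᵥ x.ofLp) / ε with ha
    set b := (⟪x, θ⟫_ℝ - y) / ε with hb
    have hb1 : |b| ≤ 1 := by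
      rw [hb, abs_div, abs_of_pos hε, div_le_one hε, abs_sub_comm]
      exact hh.2.2.1
    have hA' : z.ofLp ⬝ᵥ (V lam ((x, y) :: h) *ᵥ θ.ofLp - XWY lam ((x, y) :: h)) = A + a * b := by
      have e1 : V lam ((x, y) :: h) *ᵥ θ.ofLp - XWY lam ((x, y) :: h) =
          (V lam h *ᵥ θ.ofLp - XWY lam h) + ((⟪x, θ⟫_ℝ - y) / ε ^ 2) • x.ofLp := by
        rw [inner_eq_dotProduct, hεdef, V, XWY, Matrix.add_mulVec, Matrix.smul_mulVec,
          vecMulVec_mulVec_real, sub_div, sub_smul, smul_smul, eps, one_div_mul_eq_div]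
        abel
      rw [e1, dotProduct_add, dotProduct_smul, smul_eq_mul, ← hA, ha, hb]
      field_simp
    have hQ' : z.ofLp ⬝ᵥ (V lam ((x, y) :: h) *ᵥ z.ofLp) = Q + a ^ 2 := by
      have e1 : V lam ((x, y) :: h) *ᵥ z.ofLp =
          V lam h *ᵥ z.ofLp + ((z.ofLp ⬝ᵥ x.ofLp) / ε ^ 2) • x.ofLp := by
        rw [hεdef, V, Matrix.add_mulVec, Matrix.smul_mulVec,
          vecMulVec_mulVec_real, smul_smul, eps, one_div_mul_eq_div, dotProduct_comm]
      rw [e1, dotProduct_add, dotProduct_smul, smul_eq_mul, ← hQdef, ha]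
      field_simp
    rw [hA', hQ', List.length_cons]
    push_cast
    set R := lam * S ^ 2 + (h.length : ℝ) with hR
    have hR0 : 0 ≤ R := by positivity
    have hb2 : b ^ 2 ≤ 1 := (sq_le_one_iff_abs_le_one _).mpr hb1
    -- An inductive Cauchy–Schwarz step: from `A² ≤ R Q` and `|b| ≤ 1` follows `(A + a b)² ≤ (R + 1)
    -- (Q + a²)`, the cross term being bounded by the arithmetic mean of `R a²` and `Q`.
    have hcross : |2 * A * (a * b)| ≤ R * a ^ 2 + Q := by
      apply abs_le_of_sq_le_sq _ (by positivity)
      have h1 : A ^ 2 * (a ^ 2 * b ^ 2) ≤ (R * Q) * (a ^ 2 * 1) := by gcongr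
      nlinarith [sq_nonneg (R * a ^ 2 - Q)]
    have h2 := (abs_le.mp hcross).2
    have h3 : a ^ 2 * b ^ 2 ≤ a ^ 2 * 1 := by gcongr
    rw [show lam * S ^ 2 + ((h.length : ℝ) + 1) = R + 1 by rw [hR]; ring]
    nlinarith

/-- After accurate estimates the true parameter lies in the confidence region. -/
lemma Accurate.mem_conf (hd : 1 ≤ d) {lam L S : ℝ} (hlam : 0 < lam) {θ : Vec d}
    (hθ : ‖θ‖ ≤ S) {h : Hist d} (hh : Accurate lam L θ h) : θ ∈ conf lam S h := by
  have hS : 0 ≤ S := (norm_nonneg _).trans hθ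
  have hV := posDef_V hlam h
  -- For this test vector `z` the residual is `V z`, so the inequality reads `w⁴ ≤ (λ S² + s) w²`
  -- with `w = ‖z‖_V`.
  have hres := hh.residual_sq_le hlam hθ (θ - thetaHat lam h)
  have hVw : V lam h *ᵥ (θ - thetaHat lam h).ofLp = V lam h *ᵥ θ.ofLp - XWY lam h := by
    rw [WithLp.ofLp_sub, Matrix.mulVec_sub]
    congr 1
    simp only [thetaHat]
    rw [Matrix.mulVec_mulVec, Matrix.mul_nonsing_inv _ hV.det_pos.ne'.isUnit,
      Matrix.one_mulVec]
  rw [← hVw, ← wnorm_sq hV.posSemidef] at hres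
  have hw := wnorm_nonneg (V lam h) (θ - thetaHat lam h)
  change wnorm _ _ ≤ _
  set w := wnorm (V lam h) (θ - thetaHat lam h)
  have hd' : (1 : ℝ) ≤ d := by exact_mod_cast hd
  have hlen : (h.length : ℝ) ≤ d * h.length := le_mul_of_one_le_left (Nat.cast_nonneg _) hd'
  have hw2 : w ^ 2 ≤ lam * S ^ 2 + h.length := by
    rcases hw.eq_or_lt with h0 | h0
    · rw [← h0, zero_pow two_ne_zero]
      positivity
    · have : w ^ 2 * w ^ 2 ≤ (lam * S ^ 2 + h.length) * w ^ 2 := by rw [← sq]; exact hres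
      exact le_of_mul_le_mul_right this (by positivity)
  refine (sq_le_sq₀ hw (by positivity)).mp ?_
  have h1 := Real.sq_sqrt hlam.le
  have h2 := Real.sq_sqrt (show (0 : ℝ) ≤ d * h.length by positivity)
  have h3 : 0 ≤ Real.sqrt lam * S * Real.sqrt (d * h.length) := by positivity
  nlinarith

end LinearAlgebra

/-! ### Regret -/

section Regret
variable {d : ℕ}

lemma regret_append (θ xs : Vec d) (l₁ l₂ : List (Vec d)) :
    regret θ xs (l₁ ++ l₂) = regret θ xs l₁ + regret θ xs l₂ := by
  simp [regret]

lemma regret_replicate (θ xs x : Vec d) (n : ℕ) :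
    regret θ xs (List.replicate n x) = n * ⟪xs - x, θ⟫_ℝ := by
  simp [regret]

lemma QSLB.inner_mem_Icc {Ω : Type} [Fintype Ω] {ω₀ : Ω} {L S : ℝ} (B : QSLB d Ω ω₀ L S)
    {x : Vec d} (hx : x ∈ B.A) : ⟪x, B.θ⟫_ℝ ∈ Set.Icc (0 : ℝ) 1 := by
  rw [← B.mean_reward x hx]
  exact mean_mem_Icc _ (B.reward_mem x hx)

lemma QSLB.gap_le_one {Ω : Type} [Fintype Ω] {ω₀ : Ω} {L S : ℝ} (B : QSLB d Ω ω₀ L S)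
    {x xs : Vec d} (hx : x ∈ B.A) (hxs : xs ∈ B.A) : ⟪xs - x, B.θ⟫_ℝ ≤ 1 := by
  rw [inner_sub_left]
  have h1 := B.inner_mem_Icc hx
  have h2 := B.inner_mem_Icc hxs
  linarith [h1.1, h2.2]

/-- Optimism: the gap of the selected action is at most its accuracy times the width of the
confidence region. -/
lemma gap_le_of_mem_conf {lam S : ℝ} (hlam : 0 < lam) {A : Set (Vec d)}
    {sel : Hist d → Vec d × Vec d} (hsel : IsArgmaxRule lam S A sel) {h : Hist d}
    (hh : IsHist sel h) {θ xs : Vec d} (hθ : θ ∈ conf lam S h) (hxs : xs ∈ A) :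
    ⟪xs - (sel h).1, θ⟫_ℝ ≤
      eps lam h (sel h).1 * (2 * (Real.sqrt lam * S + Real.sqrt (d * h.length))) := by
  obtain ⟨-, h2, h3⟩ := hsel h hh
  have hV := posDef_V hlam h
  have hε : 0 ≤ eps lam h (sel h).1 := wnorm_nonneg _ _
  have key : ∀ z ∈ conf lam S h, |⟪(sel h).1, z - thetaHat lam h⟫_ℝ| ≤
      eps lam h (sel h).1 * (Real.sqrt lam * S + Real.sqrt (d * h.length)) := fun z hz =>
    (abs_inner_le_wnorm_mul hV _ _).trans (mul_le_mul_of_nonneg_left hz hε)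
  have k1 := (abs_le.mp (key _ h2)).2
  have k2 := (abs_le.mp (key _ hθ)).1
  have h4 := h3 xs hxs θ hθ
  rw [inner_sub_right] at k1 k2
  rw [inner_sub_left]
  linarith

lemma stageLen_le {C₁ m δ ε : ℝ} (hC : 0 ≤ C₁ / ε * Real.logb 2 (m / δ)) :
    (stageLen C₁ m δ ε : ℝ) ≤ C₁ / ε * Real.logb 2 (m / δ) + 1 := by
  rw [stageLen, Nat.cast_max, Nat.cast_one]
  exact max_le (by linarith) (Nat.ceil_lt_add_one hC).le

lemma le_stageLen (C₁ m δ ε : ℝ) :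
    C₁ / ε * Real.logb 2 (m / δ) ≤ stageLen C₁ m δ ε := by
  rw [stageLen, Nat.cast_max]
  exact (Nat.le_ceil _).trans (le_max_right _ _)

/-- The bound on the regret of a single stage. -/
def stageBound (C₁ m δ β : ℝ) : ℝ := (C₁ * Real.logb 2 (m / δ) + 1) * max 1 (2 * β)

lemma mul_gap_le_stageBound {C₁ m δ ε β g : ℝ} (hC : 0 ≤ C₁) (hlog : 0 ≤ Real.logb 2 (m / δ))
    (hε : 0 < ε) (hβ : 0 ≤ β) (hg1 : g ≤ 1) (hg : g ≤ ε * (2 * β)) {n : ℕ}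
    (hn : n ≤ stageLen C₁ m δ ε) : n * g ≤ stageBound C₁ m δ β := by
  have hCl : 0 ≤ C₁ * Real.logb 2 (m / δ) := mul_nonneg hC hlog
  have hN := stageLen_le (C₁ := C₁) (m := m) (δ := δ) (ε := ε) (by positivity)
  have hn' : (n : ℝ) ≤ C₁ / ε * Real.logb 2 (m / δ) + 1 := le_trans (by exact_mod_cast hn) hN
  have hn0 : (0 : ℝ) ≤ n := Nat.cast_nonneg n
  rw [stageBound]
  -- For `ε ≥ 1` the trivial gap bound `1` is used. For `ε < 1` the factor `ε` cancels the length,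
  -- and the extra round from rounding up contributes only `ε ≤ 1`.
  rcases le_or_gt 1 ε with h1 | h1
  · calc n * g ≤ n * 1 := by gcongr
      _ ≤ (C₁ / ε * Real.logb 2 (m / δ) + 1) * 1 := by gcongr
      _ ≤ (C₁ * Real.logb 2 (m / δ) + 1) * max 1 (2 * β) := by
        gcongr
        · exact div_le_self hC h1
        · exact le_max_left _ _
  · calc n * g ≤ n * (ε * (2 * β)) := by gcongr
      _ ≤ (C₁ / ε * Real.logb 2 (m / δ) + 1) * (ε * (2 * β)) := by gcongr
      _ = (C₁ * Real.logb 2 (m / δ) + ε) * (2 * β) := by field_simp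
      _ ≤ (C₁ * Real.logb 2 (m / δ) + 1) * max 1 (2 * β) := by
        gcongr
        exact le_max_right _ _

variable {Ω : Type} [Fintype Ω] {ω₀ : Ω} {L S : ℝ}

/-- With probability at least `1 - (m - s) δ / m`, where `s` is the number of completed stages, the
remaining regret is at most that of `m + 1 - s` stages. -/
lemma play_regret_tail (hd : 1 ≤ d) {C₁ lam : ℝ} (hC : 1 < C₁) (hlam : 0 < lam)
    {Q : ℝ → ℝ → QAlg Ω} (hQ : IsQMC ω₀ C₁ Q) (B : QSLB d Ω ω₀ L S)
    {sel : Hist d → Vec d × Vec d} (hsel : IsArgmaxRule lam S B.A sel) {xs : Vec d}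
    (hxs : xs ∈ B.A) {T : ℕ} {m δ : ℝ} (hm : m = numStages d L lam T) (hm1 : 1 ≤ m) (hδ : 0 < δ)
    (hδm : 2 * δ ≤ m) (n : ℕ) (h : Hist d) (hh : IsHist sel h) (ha : Accurate lam L B.θ h)
    (hT : sumInvEps lam h + n ≤ T) :
    (play ω₀ B.O Q sel C₁ lam m δ n h).toOuterMeasure
      {l | (m + 1 - h.length) * stageBound C₁ m δ (Real.sqrt lam * S + Real.sqrt (d * m)) <
        regret B.θ xs l} ≤ ENNReal.ofReal ((m - h.length) * (δ / m)) := by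
  classical
  induction n using Nat.strong_induction_on generalizing h with
  | _ n ih =>
  have hS : 0 ≤ S := (norm_nonneg _).trans B.norm_param
  have hm0 : 0 < m := by linarith
  have hlen : (h.length : ℝ) ≤ m :=
    (ha.length_le hlam hd (by linarith [(Nat.cast_nonneg n : (0 : ℝ) ≤ n)])).trans hm.ge
  have hlog : 1 ≤ Real.logb 2 (m / δ) := by
    rw [Real.le_logb_iff_rpow_le (by norm_num) (by positivity), Real.rpow_one, le_div_iff₀ hδ]
    exact hδm
  set β := Real.sqrt lam * S + Real.sqrt (d * m) with hβ
  have hβ0 : 0 ≤ β := by positivity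
  set D := stageBound C₁ m δ β with hD
  have hD0 : 0 ≤ D := by
    rw [hD, stageBound]
    exact mul_nonneg (by nlinarith) (le_trans zero_le_one (le_max_left _ _))
  obtain ⟨hxA, -, -⟩ := hsel h hh
  have hgap1 := B.gap_le_one hxA hxs
  have hgap := gap_le_of_mem_conf hlam hsel hh (ha.mem_conf hd hlam B.norm_param) hxs
  have hε0 : 0 ≤ eps lam h (sel h).1 := wnorm_nonneg _ _
  have hgap' : ⟪xs - (sel h).1, B.θ⟫_ℝ ≤ eps lam h (sel h).1 * (2 * β) := by
    refine hgap.trans ?_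
    rw [hβ]
    gcongr
  rw [play]
  split_ifs with hcase
  -- The last stage uses only earlier estimates, so it cannot fail: this is the extra `1` in the
  -- count of stages. If `ε = 0`, its gap is not positive, however long it lasts.
  · rw [PMF.toOuterMeasure_pure_apply, if_neg]
    · exact zero_le
    · rw [Set.mem_ofPred_eq, not_lt, regret_replicate]
      have h1 : D ≤ (m + 1 - h.length) * D := le_mul_of_one_le_left hD0 (by linarith)
      refine le_trans ?_ h1
      rcases hε0.eq_or_lt with h0 | h0
      · rw [← h0, zero_mul] at hgap'
        exact (mul_nonpos_of_nonneg_of_nonpos (Nat.cast_nonneg n) hgap').trans hD0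
      · exact mul_gap_le_stageBound (by linarith) (by linarith) h0 hβ0 hgap1 hgap'
          (hcase.resolve_right h0.ne')
  · rw [not_or, not_le] at hcase
    obtain ⟨hnN, hεne⟩ := hcase
    have hεpos : 0 < eps lam h (sel h).1 := lt_of_le_of_ne hε0 (Ne.symm hεne)
    have hx0 : (sel h).1 ≠ 0 := by
      intro h0
      apply hεne
      rw [h0]
      simp [eps, wnorm]
    have hN1 : 1 ≤ stageLen C₁ m δ (eps lam h (sel h).1) := le_max_left _ _
    have hgapN := mul_gap_le_stageBound (by linarith) (by linarith) hεpos hβ0 hgap1 hgap'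
      (le_refl (stageLen C₁ m δ (eps lam h (sel h).1)))
    -- This keeps the invariant `∑ 1 / ε + n ≤ T`; it holds because `C₁ > 1` and `log (m / δ) ≥ 1`.
    have hNε : 1 / eps lam h (sel h).1 ≤ stageLen C₁ m δ (eps lam h (sel h).1) := by
      refine le_trans ?_ (le_stageLen _ _ _ _)
      rw [div_mul_eq_mul_div]
      gcongr
      nlinarith
    set N := stageLen C₁ m δ (eps lam h (sel h).1) with hN
    set x := (sel h).1 with hx
    set ε := eps lam h x with hε
    have hT' : ∀ y, sumInvEps lam ((x, y) :: h) + ((n - N : ℕ) : ℝ) ≤ T := fun y => by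
      rw [sumInvEps, Nat.cast_sub hnN.le]
      linarith
    have hacc : ∀ y, |y - ⟪x, B.θ⟫_ℝ| ≤ ε → Accurate lam L B.θ ((x, y) :: h) := fun y hy =>
      ⟨hx0, B.norm_action x hxA, hy, ha⟩
    -- The bound on the length is applied to the stage with a hypothetical exact estimate. It
    -- guarantees that the failure budget left after this stage is nonnegative.
    have hlen' : (h.length : ℝ) + 1 ≤ m := by
      have h1 := (hacc ⟪x, B.θ⟫_ℝ (by simpa using hε0)).length_le hlam hd (T := T)
        (by linarith [hT' ⟪x, B.θ⟫_ℝ, (Nat.cast_nonneg (n - N) : (0 : ℝ) ≤ ((n - N : ℕ) : ℝ))])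
      rw [← hm, List.length_cons] at h1
      exact_mod_cast h1
    have hδm0 : 0 < δ / m := by positivity
    have hδm2 : δ / m ≤ 1 / 2 := by rw [div_le_iff₀ hm0]; linarith
    have hqmc := hQ.accurate ε (δ / m) hεpos hδm0 hδm2 (B.P x) (B.y x) (B.O x)
      (B.reward_mem x hxA) (B.encodes x hxA)
    rw [B.mean_reward x hxA] at hqmc
    set p := (Q ε (δ / m)).out ω₀ (B.O x) with hp
    have hrec : ∀ y, y ∉ {r | ε ≤ |r - ⟪x, B.θ⟫_ℝ|} →
        (PMF.map (fun l => List.replicate N x ++ l)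
          (play ω₀ B.O Q sel C₁ lam m δ (n - N) ((x, y) :: h))).toOuterMeasure
            {l | (m + 1 - h.length) * D < regret B.θ xs l} ≤
          ENNReal.ofReal ((m - (h.length + 1)) * (δ / m)) := fun y hy => by
      rw [Set.mem_ofPred_eq, not_le] at hy
      have h1 := ih (n - N) (by omega) ((x, y) :: h) (IsHist.cons h y hh) (hacc y hy.le) (hT' y)
      rw [List.length_cons, Nat.cast_add, Nat.cast_one] at h1
      rw [PMF.toOuterMeasure_map_apply]
      refine le_trans (MeasureTheory.OuterMeasure.mono _ ?_) h1
      intro l hl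
      rw [Set.mem_preimage, Set.mem_ofPred_eq, regret_append, regret_replicate] at hl
      rw [Set.mem_ofPred_eq]
      linarith
    rw [PMF.toOuterMeasure_bind_apply]
    -- Union bound: an inaccurate estimate is charged with its full probability, an accurate one
    -- with the inductive bound for the remaining rounds.
    calc _ ≤ ∑' y, (({r | ε ≤ |r - ⟪x, B.θ⟫_ℝ|} : Set ℝ).indicator p y +
          p y * ENNReal.ofReal ((m - (h.length + 1)) * (δ / m))) := by
          refine ENNReal.tsum_le_tsum fun y => ?_
          by_cases hy : y ∈ {r | ε ≤ |r - ⟪x, B.θ⟫_ℝ|}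
          · rw [Set.indicator_of_mem hy]
            refine le_add_right (mul_le_of_le_one_right zero_le ?_)
            rw [PMF.toOuterMeasure_apply]
            refine (ENNReal.tsum_le_tsum fun l => Set.indicator_le_self' (fun _ _ => zero_le) l).trans ?_
            exact (PMF.tsum_coe _).le
          · exact le_add_left (mul_le_mul_right (hrec y hy) _)
      _ ≤ ENNReal.ofReal (δ / m) + ENNReal.ofReal ((m - (h.length + 1)) * (δ / m)) := by
          rw [ENNReal.tsum_add, ENNReal.tsum_mul_right, p.tsum_coe, one_mul,
            ← PMF.toOuterMeasure_apply]
          gcongr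
      _ = ENNReal.ofReal ((m - h.length) * (δ / m)) := by
          rw [← ENNReal.ofReal_add hδm0.le (mul_nonneg (by linarith) hδm0.le)]
          congr 1
          ring

/-- The regret never exceeds the number of rounds. -/
lemma regret_le_of_mem_support_play {C₁ lam : ℝ} {Q : ℝ → ℝ → QAlg Ω} (B : QSLB d Ω ω₀ L S)
    {sel : Hist d → Vec d × Vec d} (hsel : IsArgmaxRule lam S B.A sel) {xs : Vec d}
    (hxs : xs ∈ B.A) {m δ : ℝ} (n : ℕ) (h : Hist d) (hh : IsHist sel h) (l : List (Vec d))
    (hl : l ∈ (play ω₀ B.O Q sel C₁ lam m δ n h).support) : regret B.θ xs l ≤ n := by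
  classical
  induction n using Nat.strong_induction_on generalizing h l with
  | _ n ih =>
  have hgap := B.gap_le_one (hsel h hh).1 hxs
  have hrep : ∀ k : ℕ, regret B.θ xs (List.replicate k (sel h).1) ≤ k := fun k => by
    rw [regret_replicate]
    exact mul_le_of_le_one_right (Nat.cast_nonneg k) hgap
  rw [play] at hl
  split_ifs at hl with hcase
  · rw [PMF.mem_support_pure_iff] at hl
    rw [hl]
    exact hrep n
  · rw [not_or, not_le] at hcase
    have hN1 : 1 ≤ stageLen C₁ m δ (eps lam h (sel h).1) := le_max_left _ _
    rw [PMF.mem_support_bind_iff] at hl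
    obtain ⟨y, -, hl⟩ := hl
    rw [PMF.mem_support_map_iff] at hl
    obtain ⟨l', hl', rfl⟩ := hl
    have h1 := ih _ (by omega) _ (IsHist.cons h y hh) l' hl'
    rw [regret_append]
    rw [Nat.cast_sub hcase.1.le] at h1
    linarith [hrep (stageLen C₁ m δ (eps lam h (sel h).1))]

end Regret

/-! ### Bounds for probabilities and expectations -/

lemma ofReal_one_sub_le_toOuterMeasure {α : Type*} (p : PMF α) {s t : Set α} {δ : ℝ} (hδ : 0 ≤ δ)
    (hst : sᶜ ⊆ t) (ht : p.toOuterMeasure t ≤ ENNReal.ofReal δ) :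
    ENNReal.ofReal (1 - δ) ≤ p.toOuterMeasure s := by
  have huniv : p.toOuterMeasure Set.univ = 1 := by
    rw [PMF.toOuterMeasure_apply, Set.indicator_univ, p.tsum_coe]
  have h1 : (1 : ℝ≥0∞) ≤ p.toOuterMeasure s + ENNReal.ofReal δ := by
    rw [← huniv, ← Set.union_compl_self s]
    exact (MeasureTheory.measure_union_le _ _).trans
      (add_le_add_right ((MeasureTheory.OuterMeasure.mono _ hst).trans ht) _)
  rw [ENNReal.ofReal_sub _ hδ, ENNReal.ofReal_one]
  exact tsub_le_iff_right.mpr h1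

lemma expectation_le_of_support {α : Type*} (p : PMF α) {f : α → ℝ} {b : ℝ}
    (h : ∀ a ∈ p.support, f a ≤ b) : expectation p f ≤ ENNReal.ofReal b := by
  calc expectation p f ≤ ∑' a, p a * ENNReal.ofReal b := by
        refine ENNReal.tsum_le_tsum fun a => ?_
        by_cases ha : a ∈ p.support
        · gcongr
          exact h a ha
        · rw [PMF.mem_support_iff, not_not] at ha
          simp [ha]
    _ = ENNReal.ofReal b := by rw [ENNReal.tsum_mul_right, p.tsum_coe, one_mul]

lemma expectation_le_add {α : Type*} (p : PMF α) {f : α → ℝ} {b c q : ℝ} (hb : 0 ≤ b) (hc : 0 ≤ c)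
    (hq : 0 ≤ q) (h : ∀ a ∈ p.support, f a ≤ b)
    (ht : p.toOuterMeasure {a | c < f a} ≤ ENNReal.ofReal q) :
    expectation p f ≤ ENNReal.ofReal (c + q * b) := by
  calc expectation p f
      ≤ ∑' a, (p a * ENNReal.ofReal c + ({a | c < f a} : Set α).indicator p a * ENNReal.ofReal b) := by
        refine ENNReal.tsum_le_tsum fun a => ?_
        by_cases hac : a ∈ {a | c < f a}
        · rw [Set.indicator_of_mem hac]
          by_cases ha : a ∈ p.support
          · exact le_add_left (mul_le_mul_right (ENNReal.ofReal_le_ofReal (h a ha)) _)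
          · rw [PMF.mem_support_iff, not_not] at ha
            simp [ha]
        · exact le_add_right (mul_le_mul_right (ENNReal.ofReal_le_ofReal (not_lt.mp hac)) _)
    _ = ENNReal.ofReal c + p.toOuterMeasure {a | c < f a} * ENNReal.ofReal b := by
        rw [ENNReal.tsum_add, ENNReal.tsum_mul_right, ENNReal.tsum_mul_right, p.tsum_coe, one_mul,
          PMF.toOuterMeasure_apply]
    _ ≤ ENNReal.ofReal c + ENNReal.ofReal q * ENNReal.ofReal b := by gcongr
    _ = ENNReal.ofReal (c + q * b) := by
        rw [← ENNReal.ofReal_mul hq, ← ENNReal.ofReal_add hc (by positivity)]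

/-- The regret of `m + 1` stages in closed form. -/
lemma stages_mul_stageBound_le {C₁ lam S δ ℓ : ℝ} {d : ℕ} (hd : 1 ≤ d) (hC : 1 < C₁)
    (hS : 0 < S) (hδ : 0 < δ) (hℓ : 0 ≤ ℓ) (hm : 1 ≤ d * ℓ) (hδm : 2 * δ ≤ d * ℓ) :
    (d * ℓ + 1) * stageBound C₁ (d * ℓ) δ (Real.sqrt lam * S + Real.sqrt (d * (d * ℓ))) ≤
      4 * C₁ * (3 + 2 * (Real.sqrt lam * S)) *
        ((d : ℝ) ^ 2 * ℓ ^ (3 / 2 : ℝ) * Real.logb 2 (d * ℓ / δ)) := by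
  have hd' : (1 : ℝ) ≤ d := by exact_mod_cast hd
  have hlog : 1 ≤ Real.logb 2 (d * ℓ / δ) := by
    rw [Real.le_logb_iff_rpow_le (by norm_num) (by positivity), Real.rpow_one, le_div_iff₀ hδ]
    exact hδm
  have hsq1 : 1 ≤ Real.sqrt (d * (d * ℓ)) := Real.one_le_sqrt.mpr (by nlinarith)
  have hsq : Real.sqrt (d * (d * ℓ)) = d * Real.sqrt ℓ := by
    rw [← mul_assoc, Real.sqrt_mul (by positivity), Real.sqrt_mul_self (by positivity)]
  have hpow : ℓ ^ (3 / 2 : ℝ) = ℓ * Real.sqrt ℓ := by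
    rw [Real.sqrt_eq_rpow, show (3 / 2 : ℝ) = 1 + 1 / 2 by norm_num,
      Real.rpow_add_of_nonneg hℓ (by norm_num) (by norm_num), Real.rpow_one]
  set g := Real.logb 2 (d * ℓ / δ)
  have hs0 : 0 ≤ Real.sqrt lam * S := by positivity
  have hmax : max 1 (2 * (Real.sqrt lam * S + Real.sqrt (d * (d * ℓ)))) ≤
      (3 + 2 * (Real.sqrt lam * S)) * Real.sqrt (d * (d * ℓ)) := by
    apply max_le <;> nlinarith
  rw [stageBound]
  calc (d * ℓ + 1) * ((C₁ * g + 1) * max 1 (2 * (Real.sqrt lam * S + Real.sqrt (d * (d * ℓ)))))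
      ≤ (2 * (d * ℓ)) * ((2 * (C₁ * g)) *
          ((3 + 2 * (Real.sqrt lam * S)) * Real.sqrt (d * (d * ℓ)))) := by
        have h1 : d * ℓ + 1 ≤ 2 * (d * ℓ) := by linarith
        have h2 : C₁ * g + 1 ≤ 2 * (C₁ * g) := by nlinarith
        gcongr
    _ = _ := by rw [hsq, hpow]; ring

/-- If `d² < T`, the logarithm of the horizon is of the order of the logarithmic term of the
regret bound. -/
lemma logb_horizon_le {L lam : ℝ} (hL : 0 < L) (hlam : 0 < lam) {d T : ℕ} (hd : 1 ≤ d)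
    (hT : (d : ℝ) ^ 2 ≤ T)
    (hℓ : 1 ≤ Real.logb 2 (L ^ 2 * (T : ℝ) ^ 2 / (d * lam) + 1)) :
    Real.logb 2 T ≤ (1 + |Real.logb 2 (L ^ 2 / lam)|) *
      Real.logb 2 (L ^ 2 * (T : ℝ) ^ 2 / (d * lam) + 1) := by
  have hd' : (0 : ℝ) < d := by exact_mod_cast hd
  have hd1 : (1 : ℝ) ≤ d := by exact_mod_cast hd
  have hT0 : (0 : ℝ) < T := lt_of_lt_of_le (by positivity) hT
  have hT1 : (1 : ℝ) ≤ T := (one_le_pow₀ hd1).trans hT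
  have hlogT : 0 ≤ Real.logb 2 T := Real.logb_nonneg (by norm_num) hT1
  have h1 : Real.logb 2 (L ^ 2 * (T : ℝ) ^ 2 / (d * lam)) ≤
      Real.logb 2 (L ^ 2 * (T : ℝ) ^ 2 / (d * lam) + 1) :=
    Real.logb_le_logb_of_le (by norm_num) (by positivity) (by linarith)
  have h2 : Real.logb 2 (L ^ 2 * (T : ℝ) ^ 2 / (d * lam)) =
      Real.logb 2 (L ^ 2 / lam) + 2 * Real.logb 2 T - Real.logb 2 d := by
    rw [show L ^ 2 * (T : ℝ) ^ 2 / (d * lam) = L ^ 2 / lam * (T : ℝ) ^ 2 / d by field_simp,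
      Real.logb_div (by positivity) hd'.ne', Real.logb_mul (by positivity) (by positivity),
      Real.logb_pow]
    norm_num
  -- So dividing by `d` costs at most half of `log T`: the logarithm of `L² T² / (d λ)` is at least
  -- `log (L² / λ) + (3 / 2) log T`.
  have h3 : 2 * Real.logb 2 d ≤ Real.logb 2 T := by
    have := Real.logb_le_logb_of_le (b := 2) (by norm_num) (by positivity) hT
    rw [Real.logb_pow] at this
    exact_mod_cast this
  have h4 := neg_abs_le (Real.logb 2 (L ^ 2 / lam))
  have h5 := abs_nonneg (Real.logb 2 (L ^ 2 / lam))
  nlinarith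

end QBandit

end

/-! ### Assembly of the four claims -/

theorem theorem3 :
    -- a quantum Monte Carlo method exists, with one constant for all sample spaces
    (∃ C₁ : ℝ, 1 < C₁ ∧ ∀ (Ω : Type) [Fintype Ω] (ω₀ : Ω),
      ∃ Q : ℝ → ℝ → QBandit.QAlg Ω, QBandit.IsQMC ω₀ C₁ Q) ∧
    -- every stage with a nonzero action doubles the determinant
    (∀ (d : ℕ) (lam : ℝ), 0 < lam → ∀ (h : QBandit.Hist d) (x : QBandit.Vec d) (y : ℝ), x ≠ 0 →
      (QBandit.V lam ((x, y) :: h)).det = 2 * (QBandit.V lam h).det) ∧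
    -- regret with high probability
    (∀ C₁ lam S : ℝ, 1 < C₁ → 0 < lam → 0 < S →
      ∃ K : ℝ, 0 < K ∧
        ∀ (Ω : Type) [Fintype Ω] (ω₀ : Ω) (Q : ℝ → ℝ → QBandit.QAlg Ω),
        QBandit.IsQMC ω₀ C₁ Q →
        ∀ (d T : ℕ) (L δ : ℝ), 1 ≤ d → 0 < L →
        0 < δ → δ < 1 →
        1 ≤ QBandit.numStages d L lam T →
        2 * δ ≤ QBandit.numStages d L lam T →
        ∀ (B : QBandit.QSLB d Ω ω₀ L S) (sel : QBandit.Hist d → QBandit.Vec d × QBandit.Vec d),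
        QBandit.IsArgmaxRule lam S B.A sel →
        ∀ xs ∈ B.A, (∀ x ∈ B.A, inner ℝ x B.θ ≤ inner ℝ xs B.θ) →
        ENNReal.ofReal (1 - δ) ≤
          (QBandit.QLinUCB₁ B Q sel C₁ lam T δ).toOuterMeasure
            {l | QBandit.regret B.θ xs l ≤
              K * ((d : ℝ) ^ 2 *
                Real.logb 2 (L ^ 2 * (T : ℝ) ^ 2 / (d * lam) + 1) ^ (3 / 2 : ℝ) *
                Real.logb 2 (QBandit.numStages d L lam T / δ))}) ∧
    -- expected regret
    (∀ C₁ lam S L : ℝ, 1 < C₁ → 0 < lam → 0 < S → 0 < L →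
      ∃ K : ℝ, 0 < K ∧
        ∀ (Ω : Type) [Fintype Ω] (ω₀ : Ω) (Q : ℝ → ℝ → QBandit.QAlg Ω),
        QBandit.IsQMC ω₀ C₁ Q →
        ∀ d T : ℕ, 1 ≤ d → 2 ≤ T → d * lam ≤ L ^ 2 * (T : ℝ) ^ 2 →
        ∀ (B : QBandit.QSLB d Ω ω₀ L S) (sel : QBandit.Hist d → QBandit.Vec d × QBandit.Vec d),
        QBandit.IsArgmaxRule lam S B.A sel →
        ∀ xs ∈ B.A, (∀ x ∈ B.A, inner ℝ x B.θ ≤ inner ℝ xs B.θ) →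
        QBandit.expectation
            (QBandit.QLinUCB₁ B Q sel C₁ lam T (QBandit.numStages d L lam T / T))
            (QBandit.regret B.θ xs) ≤
          ENNReal.ofReal (K * ((d : ℝ) ^ 2 *
            Real.logb 2 (L ^ 2 * (T : ℝ) ^ 2 / (d * lam) + 1) ^ (5 / 2 : ℝ)))) := by
  have hℓ_nonneg : ∀ (d T : ℕ) (L lam : ℝ), 0 < lam →
      0 ≤ Real.logb 2 (L ^ 2 * (T : ℝ) ^ 2 / (d * lam) + 1) := fun d T L lam hlam => by
    refine Real.logb_nonneg (by norm_num) ?_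
    have : 0 ≤ L ^ 2 * (T : ℝ) ^ 2 / (d * lam) := by positivity
    linarith
  refine ⟨⟨27648, by norm_num, fun Ω _ ω₀ => ⟨_, QBandit.isQMC_searchAlg ω₀⟩⟩,
    fun d lam hlam h x y hx => QBandit.det_V_cons hlam h y hx, ?_, ?_⟩
  · intro C₁ lam S hC hlam hS
    refine ⟨4 * C₁ * (3 + 2 * (Real.sqrt lam * S)), by positivity, ?_⟩
    intro Ω _ ω₀ Q hQ d T L δ hd _ hδ _ hm hδm B sel hsel xs hxs _
    have htail := QBandit.play_regret_tail hd hC hlam hQ B hsel hxs rfl hm hδ hδm T []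
      QBandit.IsHist.nil trivial (by simp [QBandit.sumInvEps])
    rw [List.length_nil, Nat.cast_zero, sub_zero, sub_zero, mul_div_cancel₀ δ (by linarith)] at htail
    refine QBandit.ofReal_one_sub_le_toOuterMeasure _ hδ.le ?_ htail
    intro l hl
    rw [Set.mem_compl_iff, Set.mem_ofPred_eq, not_le] at hl
    exact (QBandit.stages_mul_stageBound_le hd hC hS hδ (hℓ_nonneg d T L lam hlam) hm hδm).trans_lt hl
  · intro C₁ lam S L hC hlam hS hL
    set c := |Real.logb 2 (L ^ 2 / lam)| with hc
    refine ⟨4 * C₁ * (3 + 2 * (Real.sqrt lam * S)) * (1 + c) + 1, by positivity, ?_⟩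
    intro Ω _ ω₀ Q hQ d T hd hT hLT B sel hsel xs hxs _
    have hd1 : (1 : ℝ) ≤ d := by exact_mod_cast hd
    have hT2 : (2 : ℝ) ≤ T := by exact_mod_cast hT
    have hℓ : 1 ≤ Real.logb 2 (L ^ 2 * (T : ℝ) ^ 2 / (d * lam) + 1) := by
      rw [Real.le_logb_iff_rpow_le (by norm_num) (by positivity), Real.rpow_one]
      have : 1 ≤ L ^ 2 * (T : ℝ) ^ 2 / (d * lam) := by rwa [one_le_div (by positivity)]
      linarith
    have hmax : ∀ l ∈ (QBandit.QLinUCB₁ B Q sel C₁ lam T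
        (QBandit.numStages d L lam T / T)).support, QBandit.regret B.θ xs l ≤ T :=
      QBandit.regret_le_of_mem_support_play B hsel hxs T [] QBandit.IsHist.nil
    have hlogT := QBandit.logb_horizon_le (T := T) hL hlam hd
    have hm_eq : QBandit.numStages d L lam T =
      d * Real.logb 2 (L ^ 2 * (T : ℝ) ^ 2 / (d * lam) + 1) := rfl
    rw [← hc] at hlogT
    set ℓ := Real.logb 2 (L ^ 2 * (T : ℝ) ^ 2 / (d * lam) + 1) with hℓdef
    set m := QBandit.numStages d L lam T with hmdef
    have hm1 : 1 ≤ m := by rw [hm_eq]; exact one_le_mul_of_one_le_of_one_le hd1 hℓ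
    have hδ : 0 < m / T := by positivity
    -- This is where `T ≥ 2` enters. The tail bound asks for `2 δ ≤ m` only, so `m / T` need not be
    -- below `1`.
    have hδm : 2 * (m / T) ≤ m := by
      rw [← mul_div_assoc, div_le_iff₀ (by linarith)]
      nlinarith
    set κ := 4 * C₁ * (3 + 2 * (Real.sqrt lam * S)) with hκ
    have hκ0 : 0 ≤ κ := by positivity
    have hpow1 : 1 ≤ ℓ ^ (5 / 2 : ℝ) := Real.one_le_rpow hℓ (by norm_num)
    -- If `d² ≤ T`, then `log (m / δ) = log T` is at most `(1 + c) ℓ`, which raises the exponent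
    -- from `3 / 2` to `5 / 2`. If `T < d²`, the regret is at most `T` and already below the bound.
    rcases le_or_gt ((d : ℝ) ^ 2) T with hdT | hdT
    · have htail := QBandit.play_regret_tail hd hC hlam hQ B hsel hxs hmdef hm1 hδ hδm T []
        QBandit.IsHist.nil trivial (by simp [QBandit.sumInvEps])
      have hX := QBandit.stages_mul_stageBound_le (lam := lam) hd hC hS hδ
        (zero_le_one.trans hℓ) (by rwa [← hm_eq]) (by rwa [← hm_eq])
      rw [← hm_eq, div_div_cancel₀ (by linarith), ← hκ] at hX
      rw [List.length_nil, Nat.cast_zero, sub_zero, sub_zero,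
        mul_div_cancel₀ (m / T) (by linarith)] at htail
      have hX0 : 0 ≤ κ * ((d : ℝ) ^ 2 * ℓ ^ (3 / 2 : ℝ) * Real.logb 2 T) := by
        have := Real.logb_nonneg (b := 2) (by norm_num) (by linarith : (1 : ℝ) ≤ T)
        positivity
      refine (QBandit.expectation_le_add _ (by positivity) hX0 hδ.le hmax
        (le_trans (MeasureTheory.OuterMeasure.mono _ fun l hl => hX.trans_lt hl) htail)).trans
        (ENNReal.ofReal_le_ofReal ?_)
      rw [div_mul_cancel₀ _ (by linarith)]
      have hpow : ℓ ^ (5 / 2 : ℝ) = ℓ ^ (3 / 2 : ℝ) * ℓ := by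
        rw [show (5 / 2 : ℝ) = 3 / 2 + 1 by norm_num, Real.rpow_add (by linarith), Real.rpow_one]
      have hm_le : m ≤ (d : ℝ) ^ 2 * ℓ ^ (5 / 2 : ℝ) := by
        rw [hm_eq]
        have h1 : ℓ ≤ ℓ ^ (5 / 2 : ℝ) := Real.self_le_rpow_of_one_le hℓ (by norm_num)
        have h2 : (d : ℝ) ≤ (d : ℝ) ^ 2 := le_self_pow₀ hd1 two_ne_zero
        gcongr
      calc κ * ((d : ℝ) ^ 2 * ℓ ^ (3 / 2 : ℝ) * Real.logb 2 T) + m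
          ≤ κ * ((d : ℝ) ^ 2 * ℓ ^ (3 / 2 : ℝ) * ((1 + c) * ℓ)) +
            (d : ℝ) ^ 2 * ℓ ^ (5 / 2 : ℝ) := by
              have := hlogT hdT hℓ
              gcongr
        _ = (κ * (1 + c) + 1) * ((d : ℝ) ^ 2 * ℓ ^ (5 / 2 : ℝ)) := by rw [hpow]; ring
    · refine (QBandit.expectation_le_of_support _ hmax).trans (ENNReal.ofReal_le_ofReal ?_)
      have hκc : 1 ≤ κ * (1 + c) + 1 := by
        have : 0 ≤ κ * (1 + c) := by positivity
        linarith
      calc (T : ℝ) ≤ (d : ℝ) ^ 2 := hdT.le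
        _ ≤ (d : ℝ) ^ 2 * ℓ ^ (5 / 2 : ℝ) := le_mul_of_one_le_right (by positivity) hpow1
        _ ≤ _ := le_mul_of_one_le_left (by positivity) hκc
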